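/- **Language.** Fix a first-order language with equality, with a unary predicate $\mathrm{Ur}(x)$ ("$x$ is an individual"), binary predicates $x\in y$, $\mathrm{Sk}(f,x)$ ("$x$ is the generalized skand with component sequence $f$") and $x\in\mathbf V^{(\nu)}$, and a constant $c_\nu$ for every ordinal $\nu$. An *element* is an object that belongs to some class; a *set* is an element that is not an individual. Let $\mathcal U$ denote the class of individuals. **$NBG^-$** is von Neumann–Bernays–Gödel class theory with individuals and without foundation: individuals are elements and have no members; extensionality for objects that are not individuals; class comprehension for all formulas of the language without class quantifiers (with class parameters); pairing, union, power set, infinity, replacement; and von Neumann's axiom $\mathbf N$: there is a bijection of the class of all sets onto the class $\mathbf{On}$ of all von Neumann ordinals. **Skands.** For $\nu\ge 1$, a *$\nu$-sequence* is a function $f$ on a set of ordinals $\{\beta:\alpha_0\le\beta<\alpha\}$ with $\alpha_0<\alpha$, each of whose values (components) is a possibly empty set of elements of $\mathcal U\cup\bigcup_{\mu<\nu}\mathbf V^{(\mu)}$. A *$\nu$-generalized skand* is an $x$ with $\mathrm{Sk}(f,x)$ for some $\nu$-sequence $f$. Two sequences are *similar* if there is an order isomorphism between their domains under which corresponding components are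 equal. A class $K$ is *$\nu$-closed* if it contains $\bigcup_{\mu<\nu}\mathbf V^{(\mu)}$ and every set whose elements all lie in $\mathcal U\cup K$. **Skand axioms** over a given initial segment $\Lambda$ of the ordinals: 1. For $\nu\in\Lambda$, $\mathbf V^{(\nu)}$ consists of the sets that belong to every $\nu$-closed class containing all $\nu$-generalized skands (so $\mathbf V^{(0)}$ consists of the well-founded sets over $\mathcal U$); $x\in\mathbf V^{(\nu)}$ is false if $\nu\notin\Lambda$. 2. If $\nu\in\Lambda$ and $f$ is a $\nu$-sequence, then $\mathrm{Sk}(f,x)$ for some $x$. If $\mathrm{Sk}(f,x)$, then $x$ is a set and $f$ is a $\nu$-sequence for some $\nu\in\Lambda$. 3. If $\mathrm{Sk}(f,x)$, then the elements of $x$ are the elements of the first component of $f$ and, if $f$ has more than one component, the skand whose sequence is $f$ without its first component. 4. If $\mathrm{Sk}(f,x)$, $\mathrm{Sk}(g,y)$ and $f,g$ are similar, then $x=y$. If $f,g$ are $\nu$-sequences with $\nu\in\Lambda$, $\mathrm{Sk}(f,x)$, $\mathrm{Sk}(g,x)$, and some $\nu$-closed class does not contain $x$ (i.e. $x$ is a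 $\nu$-pseudo-individual), then $f$ and $g$ are similar. 5. Every set belongs to $\mathbf V^{(\nu)}$ for some $\nu\in\Lambda$. **The theories.** For an ordinal $\lambda$, $NBG^{(\lambda)}$ consists of $NBG^-$, the axioms saying that the $c_\nu$ ($\nu\le\lambda$) are ordinals with $c_\mu\in c_\nu$ for $\mu<\nu\le\lambda$, that $c_0=\emptyset$, $c_{\nu+1}=c_\nu\cup\{c_\nu\}$ when $\nu+1\le\lambda$, and that $c_\nu$ is a limit when $\nu\le\lambda$ is, and the skand axioms over $\Lambda=\{\nu:\nu\le c_\lambda\}$. The theory $NBG^{(\Omega)}$ consists of $NBG^-$, the axioms on the constants $c_\nu$ for all ordinals $\nu$, and the skand axioms over $\Lambda=\mathbf{On}$; its universe of sets is thus $\bigcup_{\lambda\in\mathbf{On}}\mathbf V^{(\lambda)}$. A theory is *consistent* if no contradiction is derivable from it in classical first-order logic with equality. **Theorem 3.** If $NBG^{(\lambda)}$ is consistent for every ordinal $\lambda$, then $NBG^{(\Omega)}$ is consistent. -/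

import Mathlib

open FirstOrder FirstOrder.Language

universe u

namespace Skand

/-! ### Classical first-order provability and consistency -/

section Provability

/-- The formula `φ(t)`, where `φ` has one distinguished (bound) variable. -/
def inst {L : FirstOrder.Language} {α : Type} (φ : L.BoundedFormula α 1) (t : L.Term α) : L.Formula α :=
  BoundedFormula.subst φ.toFormula (Sum.elim Term.var fun _ => t)

/-- Classical natural deduction with equality. `Provable Γ φ` means that the formula `φ`, with free
variables in `α`, is derivable from the assumptions `Γ`. In the rule `allI` the bound variable of
`φ` is replaced by a variable that is new with respect to `α`. -/
inductive Provable {L : FirstOrder.Language} : {α : Type} → Set (L.Formula α) → L.Formula α → Prop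
  | ax {α : Type} {Γ : Set (L.Formula α)} {φ : L.Formula α} : φ ∈ Γ → Provable Γ φ
  | impI {α : Type} {Γ : Set (L.Formula α)} {φ ψ : L.Formula α} :
      Provable (insert φ Γ) ψ → Provable Γ (φ.imp ψ)
  | impE {α : Type} {Γ : Set (L.Formula α)} {φ ψ : L.Formula α} :
      Provable Γ (φ.imp ψ) → Provable Γ φ → Provable Γ ψ
  | raa {α : Type} {Γ : Set (L.Formula α)} {φ : L.Formula α} :
      Provable (insert φ.not Γ) BoundedFormula.falsum → Provable Γ φ
  | allI {α : Type} {Γ : Set (L.Formula α)} {φ : L.BoundedFormula α 1} :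
      Provable (Formula.relabel (Sum.inl : α → α ⊕ Fin 1) '' Γ) φ.toFormula → Provable Γ φ.all
  | allE {α : Type} {Γ : Set (L.Formula α)} {φ : L.BoundedFormula α 1} (t : L.Term α) :
      Provable Γ φ.all → Provable Γ (inst φ t)
  | eqRefl {α : Type} {Γ : Set (L.Formula α)} (t : L.Term α) : Provable Γ (t.equal t)
  | eqSubst {α : Type} {Γ : Set (L.Formula α)} (φ : L.BoundedFormula α 1) {t s : L.Term α} :
      Provable Γ (t.equal s) → Provable Γ (inst φ t) → Provable Γ (inst φ s)

/-- A theory is consistent if no contradiction can be derived from it. -/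
def Consistent {L : FirstOrder.Language} (T : L.Theory) : Prop :=
  ¬ Provable (α := Empty) T BoundedFormula.falsum

end Provability

/-! ### The language -/

/-- A name for every ordinal. -/
inductive Func : ℕ → Type (u + 1)
  | name : Ordinal.{u} → Func 0

/-- The predicates of the language: `ur x` (`x` is an individual), `mem x y` (`x ∈ y`),
`skand f x` (`x` is the generalized skand with the sequence of components `f`), and
`level ν x` (`x` belongs to the class of sets `V^(ν)`). -/
inductive Pred : ℕ → Type
  | ur : Pred 1
  | mem : Pred 2
  | skand : Pred 2
  | level : Pred 2

/-- The language of class theory with individuals and skands. -/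
def Lang : FirstOrder.Language.{u + 1, 0} := ⟨Func.{u}, Pred⟩

/-- Terms with the variables `0, …, n - 1`. -/
abbrev Tm (n : ℕ) := Lang.{u}.Term (Empty ⊕ Fin n)

/-- Formulas with the free variables `0, …, n - 1`. -/
abbrev Fm (n : ℕ) := Lang.{u}.BoundedFormula Empty n

/-- A term seen in a context with one more variable. -/
def lift {n : ℕ} (t : Tm.{u} n) : Tm.{u} (n + 1) := t.relabel (Sum.map id Fin.castSucc)

instance (n : ℕ) : Coe (Tm.{u} n) (Tm.{u} (n + 1)) := ⟨lift⟩

/-- The last variable of a context. -/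
def lastVar (n : ℕ) : Tm.{u} (n + 1) := Term.var (Sum.inr (Fin.last n))

/-- `all fun x => φ x` is the formula `∀ x, φ x`. -/
def all {n : ℕ} (φ : Tm.{u} (n + 1) → Fm.{u} (n + 1)) : Fm.{u} n := (φ (lastVar n)).all

/-- `ex fun x => φ x` is the formula `∃ x, φ x`. -/
def ex {n : ℕ} (φ : Tm.{u} (n + 1) → Fm.{u} (n + 1)) : Fm.{u} n := (φ (lastVar n)).ex

def conj {n : ℕ} (φ ψ : Fm.{u} n) : Fm.{u} n := φ ⊓ ψ

def disj {n : ℕ} (φ ψ : Fm.{u} n) : Fm.{u} n := φ ⊔ ψ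

def eq {n : ℕ} (x y : Tm.{u} n) : Fm.{u} n := x.bdEqual y

/-- The name of the ordinal `ν`. -/
def name {n : ℕ} (ν : Ordinal.{u}) : Tm.{u} n :=
  Constants.term (L := Lang.{u}) (Func.name ν : Lang.{u}.Functions 0)

def ur {n : ℕ} (x : Tm.{u} n) : Fm.{u} n :=
  Relations.boundedFormula₁ (L := Lang.{u}) (Pred.ur : Lang.{u}.Relations 1) x

def mem {n : ℕ} (x y : Tm.{u} n) : Fm.{u} n :=
  Relations.boundedFormula₂ (L := Lang.{u}) (Pred.mem : Lang.{u}.Relations 2) x y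

def skand {n : ℕ} (f x : Tm.{u} n) : Fm.{u} n :=
  Relations.boundedFormula₂ (L := Lang.{u}) (Pred.skand : Lang.{u}.Relations 2) f x

def level {n : ℕ} (ν x : Tm.{u} n) : Fm.{u} n :=
  Relations.boundedFormula₂ (L := Lang.{u}) (Pred.level : Lang.{u}.Relations 2) ν x

local infixr:69 " ⋀ " => conj
local infixr:68 " ⋁ " => disj
local infix:88 " ≐ " => eq
local infix:88 " ε " => mem

/-! ### Basic notions of class theory -/

/-- `x` is an element of some class, that is, a set or an individual. -/
def isElem {n : ℕ} (x : Tm.{u} n) : Fm.{u} n := ex fun y => x ε y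

/-- `x` is a set. -/
def isSet {n : ℕ} (x : Tm.{u} n) : Fm.{u} n := isElem x ⋀ ∼(ur x)

/-- Every element of `x` is an element of `y`. -/
def sub {n : ℕ} (x y : Tm.{u} n) : Fm.{u} n := all fun z => z ε x ⟹ z ε y

/-- `s = {x, y}` -/
def isUPair {n : ℕ} (s x y : Tm.{u} n) : Fm.{u} n :=
  isSet s ⋀ all fun z => z ε s ⇔ (z ≐ x ⋁ z ≐ y)

/-- `p = ⟨x, y⟩ = {{x}, {x, y}}` -/
def isPair {n : ℕ} (p x y : Tm.{u} n) : Fm.{u} n :=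
  ex fun a => ex fun b => isUPair a x x ⋀ isUPair b x y ⋀ isUPair p a b

/-- `⟨x, y⟩ ∈ f` -/
def maps {n : ℕ} (f x y : Tm.{u} n) : Fm.{u} n := ex fun p => isPair p x y ⋀ p ε f

/-- `a` is a von Neumann ordinal: a transitive set of sets that is well-ordered by `∈`. -/
def isOrd {n : ℕ} (a : Tm.{u} n) : Fm.{u} n :=
  isSet a ⋀
  (all fun x => x ε a ⟹ (isSet x ⋀ sub x a)) ⋀
  (all fun x => all fun y => (x ε a ⋀ y ε a) ⟹ (x ε y ⋁ x ≐ y ⋁ y ε x)) ⋀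
  (all fun s => (isSet s ⋀ sub s a ⋀ ex fun x => x ε s) ⟹
    ex fun m => m ε s ⋀ all fun x => x ε s ⟹ ∼(x ε m))

/-! ### Class theory without the axiom of foundation -/

/-- The formula with all quantifiers restricted to sets and individuals. -/
def relativize : {n : ℕ} → Fm.{u} n → Fm.{u} n
  | _, .falsum => .falsum
  | _, .equal t s => .equal t s
  | _, .rel R ts => .rel R ts
  | _, .imp φ ψ => (relativize φ).imp (relativize ψ)
  | n, .all φ => ((isElem (lastVar n)).imp (relativize φ)).all

/-- Class comprehension for `φ`, a formula without quantification over classes: for all values of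
the parameters `0, …, n - 1` there is a class `K` of all sets and individuals `x` such that
`φ(0, …, n - 1, x)`. The lifting makes room for `K`. -/
def comprehension {n : ℕ} (φ : Fm.{u} (n + 1)) : Lang.{u}.Sentence :=
  BoundedFormula.alls (ex (n := n) fun K => ∼(ur K) ⋀
    all fun x => x ε K ⇔ (isElem x ⋀ (relativize φ).liftAt 1 n))

/-- Individuals can be elements of classes, and have no elements. -/
def individuals : Lang.{u}.Sentence :=
  all fun x => ur x ⟹ (isElem x ⋀ all fun z => ∼(z ε x))

def extensionality : Lang.{u}.Sentence :=
  all fun X => all fun Y => (∼(ur X) ⋀ ∼(ur Y) ⋀ all fun z => z ε X ⇔ z ε Y) ⟹ X ≐ Y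

def pairing : Lang.{u}.Sentence :=
  all fun x => all fun y => (isElem x ⋀ isElem y) ⟹ ex fun p => isUPair p x y

def union : Lang.{u}.Sentence :=
  all fun x => isSet x ⟹ ex fun v => isSet v ⋀ all fun z => z ε v ⇔ ex fun y => y ε x ⋀ z ε y

def powerSet : Lang.{u}.Sentence :=
  all fun x => isSet x ⟹ ex fun p => isSet p ⋀ all fun z => z ε p ⇔ (isSet z ⋀ sub z x)

def infinity : Lang.{u}.Sentence :=
  ex fun a => isSet a ⋀ (ex fun e => e ε a ⋀ isSet e ⋀ all fun z => ∼(z ε e)) ⋀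
    all fun x => x ε a ⟹ ex fun y => y ε a ⋀ all fun z => z ε y ⇔ (z ε x ⋁ z ≐ x)

/-- The image of a set under a class function, possibly a partial one, is a set. -/
def replacement : Lang.{u}.Sentence :=
  all fun F => (all fun x => all fun y => all fun z => (maps F x y ⋀ maps F x z) ⟹ y ≐ z) ⟹
    all fun a => isSet a ⟹
      ex fun b => isSet b ⋀ all fun y => y ε b ⇔ ex fun x => x ε a ⋀ maps F x y

/-- The axiom `N` of von Neumann: there is a bijection of the class of all sets onto the class of
all ordinals. -/
def axiomN : Lang.{u}.Sentence :=
  ex fun F =>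
    (all fun x => isSet x ⟹ ex fun a => maps F x a) ⋀
    (all fun a => isOrd a ⟹ ex fun x => maps F x a) ⋀
    (all fun x => all fun a => maps F x a ⟹ (isSet x ⋀ isOrd a)) ⋀
    (all fun x => all fun a => all fun y => all fun b =>
      (maps F x a ⋀ maps F y b) ⟹ (x ≐ y ⇔ a ≐ b))

/-- Von Neumann–Bernays–Gödel class theory with individuals and the axiom `N`, without the axiom of
foundation. -/
def nbgMinus : Lang.{u}.Theory :=
  {individuals, extensionality, pairing, union, powerSet, infinity, replacement, axiomN} ∪
    ⋃ n : ℕ, Set.range (comprehension (n := n))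

/-! ### Generalized skands -/

/-- `z` is an individual or a set in `V^(μ)` for some `μ < ν`. -/
def below {n : ℕ} (ν z : Tm.{u} n) : Fm.{u} n :=
  ur z ⋁ ex fun μ => μ ε ν ⋀ level μ z

/-- `f` is the sequence of components of a `ν`-generalized skand, `ν ≥ 1`: a function on the set of
all ordinals `β` with `a ≤ β < b`, for some ordinals `a < b`, whose values are sets, possibly empty,
of individuals and of members of the classes `V^(μ)`, `μ < ν`. -/
def isSeq {n : ℕ} (ν f : Tm.{u} n) : Fm.{u} n :=
  (ex fun μ => μ ε ν) ⋀ isSet f ⋀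
  (ex fun a => ex fun b => isOrd a ⋀ isOrd b ⋀ a ε b ⋀
    (all fun p => p ε f ⟹
      ex fun β => ex fun y => isPair p β y ⋀ (β ≐ a ⋁ a ε β) ⋀ β ε b) ⋀
    (all fun β => ((β ≐ a ⋁ a ε β) ⋀ β ε b) ⟹ ex fun y => maps f β y)) ⋀
  (all fun β => all fun y => all fun z => (maps f β y ⋀ maps f β z) ⟹ y ≐ z) ⋀
  (all fun β => all fun y => maps f β y ⟹ (isSet y ⋀ all fun z => z ε y ⟹ below ν z))

/-- `y` is a `ν`-generalized skand. -/
def isSkand {n : ℕ} (ν y : Tm.{u} n) : Fm.{u} n := ex fun f => isSeq ν f ⋀ skand f y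

/-- `z` is an element of the first component of the sequence `f`. -/
def inFirst {n : ℕ} (f z : Tm.{u} n) : Fm.{u} n :=
  ex fun a => ex fun y => maps f a y ⋀ z ε y ⋀ all fun b => all fun w => maps f b w ⟹ ∼(b ε a)

/-- `g` is the sequence `f` without its first component. -/
def isTail {n : ℕ} (f g : Tm.{u} n) : Fm.{u} n :=
  isSet g ⋀ all fun p => p ε g ⇔ (p ε f ⋀
    ex fun a => ex fun y => ex fun b => ex fun w => isPair p a y ⋀ maps f b w ⋀ b ε a)

/-- The equality criterion for skands: there is an order isomorphism `h` of the index sets of `f`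
and `g` such that corresponding components are equal. -/
def similar {n : ℕ} (f g : Tm.{u} n) : Fm.{u} n :=
  ex fun h => isSet h ⋀
    (all fun a => all fun y => maps f a y ⟹ ex fun b => maps h a b ⋀ maps g b y) ⋀
    (all fun b => all fun y => maps g b y ⟹ ex fun a => maps h a b ⋀ maps f a y) ⋀
    (all fun a => all fun b => all fun c => all fun d =>
      (maps h a b ⋀ maps h c d) ⟹ (a ε c ⇔ b ε d))

/-- The class `K` contains every `V^(μ)`, `μ < ν`, and every set all of whose elements are
individuals or members of `K`. -/
def closed {n : ℕ} (ν K : Tm.{u} n) : Fm.{u} n :=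
  (all fun y => (ex fun μ => μ ε ν ⋀ level μ y) ⟹ y ε K) ⋀
  (all fun s => (isSet s ⋀ all fun z => z ε s ⟹ (ur z ⋁ z ε K)) ⟹ s ε K)

/-- `x` belongs to the class of sets generated by the classes `V^(μ)`, `μ < ν`, alone. For a
successor `ν` this class is `V^(ν - 1)`. -/
def isOld {n : ℕ} (ν x : Tm.{u} n) : Fm.{u} n :=
  isSet x ⋀ all fun K => closed ν K ⟹ x ε K

/-- `x` belongs to the class of sets generated by the classes `V^(μ)`, `μ < ν`, and by the
`ν`-generalized skands. -/
def isGenerated {n : ℕ} (ν x : Tm.{u} n) : Fm.{u} n :=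
  isSet x ⋀ all fun K => (closed ν K ⋀ all fun y => isSkand ν y ⟹ y ε K) ⟹ x ε K

/-! ### The skand axioms

The argument `lev` tells over which ordinals `ν` the hierarchy `V^(ν)` extends. -/

section Axioms

/-- The recursive definition of the hierarchy: `V^(ν)` is the class of sets generated by the
classes `V^(μ)`, `μ < ν`, and by the `ν`-generalized skands. -/
def hierarchy (lev : {n : ℕ} → Tm.{u} n → Fm.{u} n) : Lang.{u}.Sentence :=
  all fun ν => all fun x => level ν x ⇔ (lev ν ⋀ isGenerated ν x)

/-- Every sequence of components of a `ν`-generalized skand determines a `ν`-generalized skand. -/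
def skandExistence (lev : {n : ℕ} → Tm.{u} n → Fm.{u} n) : Lang.{u}.Sentence :=
  all fun ν => all fun f => (lev ν ⋀ isSeq ν f) ⟹ ex fun x => skand f x

/-- Generalized skands are sets, and they all arise from sequences of components. -/
def skandSort (lev : {n : ℕ} → Tm.{u} n → Fm.{u} n) : Lang.{u}.Sentence :=
  all fun f => all fun x => skand f x ⟹ (isSet x ⋀ ex fun ν => lev ν ⋀ isSeq ν f)

/-- A skand is the set whose elements are the elements of its first component and, if it has more
than one component, the skand formed by the remaining components. -/
def skandElements : Lang.{u}.Sentence :=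
  all fun f => all fun x => skand f x ⟹
    all fun z => z ε x ⇔ (inFirst f z ⋁ ex fun g => isTail f g ⋀ skand g z)

/-- Skands with similar sequences of components are equal. -/
def skandEquality : Lang.{u}.Sentence :=
  all fun f => all fun g => all fun x => all fun y =>
    (skand f x ⋀ skand g y ⋀ similar f g) ⟹ x ≐ y

/-- Equal `ν`-pseudo-individuals, that is, `ν`-generalized skands that are not generated by the
classes `V^(μ)`, `μ < ν`, alone, have similar sequences of components. -/
def skandInequality (lev : {n : ℕ} → Tm.{u} n → Fm.{u} n) : Lang.{u}.Sentence :=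
  all fun ν => all fun f => all fun g => all fun x =>
    (lev ν ⋀ isSeq ν f ⋀ isSeq ν g ⋀ skand f x ⋀ skand g x ⋀ ∼(isOld ν x)) ⟹ similar f g

/-- Every set belongs to the hierarchy. -/
def exhaustion (lev : {n : ℕ} → Tm.{u} n → Fm.{u} n) : Lang.{u}.Sentence :=
  all fun x => isSet x ⟹ ex fun ν => lev ν ⋀ level ν x

def skandAxioms (lev : {n : ℕ} → Tm.{u} n → Fm.{u} n) : Lang.{u}.Theory :=
  {hierarchy lev, skandExistence lev, skandSort lev, skandElements, skandEquality,
    skandInequality lev, exhaustion lev}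

end Axioms

/-! ### The theories -/

/-- The names of the ordinals `ν ≤ l` denote ordinals, in the right order, and the names of zero,
successors and limits denote zero, successors and limits, respectively. -/
def naming (l : Ordinal.{u}) : Lang.{u}.Theory :=
  {φ | ∃ ν ≤ l, φ = isOrd (name ν)} ∪
  {φ | ∃ μ ν, μ < ν ∧ ν ≤ l ∧ φ = name μ ε name ν} ∪
  {all fun z => ∼(z ε name 0)} ∪
  {φ | ∃ ν, Order.succ ν ≤ l ∧
    φ = all fun z => z ε name (Order.succ ν) ⇔ (z ε name ν ⋁ z ≐ name ν)} ∪
  {φ | ∃ ν ≤ l, Order.IsSuccLimit ν ∧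
    φ = all fun z => z ε name ν ⟹ ex fun w => w ε name ν ⋀ z ε w}

/-- The theory `NBG^(l)`, whose universe of sets is `V^(l)`. -/
def NBG (l : Ordinal.{u}) : Lang.{u}.Theory :=
  nbgMinus ∪ naming l ∪ skandAxioms fun ν => ν ε name l ⋁ ν ≐ name l

/-- The theory `NBG^(Ω)`, whose universe of sets is the union of the classes `V^(ν)` over all
ordinals `ν`. -/
def NBGOmega : Lang.{u}.Theory :=
  nbgMinus ∪ (⋃ l : Ordinal.{u}, naming l) ∪ skandAxioms fun ν => isOrd ν

end Skand

namespace Skand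

/-! ### Soundness of the deduction rules -/

section Soundness

/-! By soundness it is enough to exhibit a structure in which `NBGOmega` holds. Its objects are all
subsets of a type `E` of sets; an object is an element when it is the extension of some `e : E`.
There are no individuals, the constants name the von Neumann ordinals of `E`, and class
comprehension is automatic because every subset of `E` is an object.

The work lies in `E`, which must be extensional and yet contain descending chains e₀ = a₀ ∪ {e₁}, e₁
= a₁ ∪ {e₂}, … A skand of this kind is coded by its whole sequence of components, which is
well-founded data in `ZFSet`, and membership is read off from the code. To represent each set
exactly once, skand codes are reserved for pure sequences: infinite ones whose level does not drop
when finitely many components are removed. Every small set of codes that is not the extension of a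
pure skand gets an ordinary code. In a pure skand of level o the tail is the only element of level
o, so the extension determines the tail and the first component, hence the sequence
(`skElements_injOn`); extensionality follows (`elems_injective`).

Since ordinals do not descend forever, an infinite sequence becomes pure after finitely many
removals, and a finite one shrinks to a single component. The other skands are obtained from these
by adjoining components one at a time (`Gives`).

V^(o) is the class of sets of level at most o. It is closed under forming sets
(`level_le_of_forall`), and it is generated by the skands of level at most o (`mem_of_level_le`). A
skand of level at most o that does not come from a pure sequence of level o is already generated by
lower levels (`mem_or_pure`), so pseudo-individuals come from pure sequences, which they determine.
Axiom N holds because the sets of each rank form a small layer, so that `E` is equinumerous with the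
ordinals. -/

theorem realize_inst {L : FirstOrder.Language} {α : Type} {M : Type*} [L.Structure M]
    (φ : L.BoundedFormula α 1) (t : L.Term α) (v : α → M) :
    (inst φ t).Realize v ↔ φ.Realize v (fun _ => t.realize v) := by
  unfold inst
  rw [Formula.Realize, BoundedFormula.realize_subst, ← Formula.Realize,
    BoundedFormula.realize_toFormula]
  exact Iff.rfl

theorem snoc_zero {M : Type*} (xs : Fin 0 → M) (a : M) :
    (Fin.snoc xs a : Fin 1 → M) = fun _ => a := by
  funext i
  obtain rfl : i = Fin.last 0 := by ext; omega
  exact Fin.snoc_last (α := fun _ => M) a xs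

/-- Provable formulas hold in every structure in which the assumptions hold. -/
theorem Provable.sound {L : FirstOrder.Language} {M : Type*} [L.Structure M] {α : Type}
    {Γ : Set (L.Formula α)} {φ : L.Formula α} (h : Provable Γ φ) :
    ∀ v : α → M, (∀ ψ ∈ Γ, ψ.Realize v) → φ.Realize v := by
  induction h with
  | ax h => exact fun v hΓ => hΓ _ h
  | impI _ ih =>
    intro v hΓ
    rw [Formula.realize_imp]
    intro hφ
    refine ih v ?_
    rintro ψ (rfl | hψ)
    exacts [hφ, hΓ _ hψ]
  | impE _ _ ih₁ ih₂ =>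
    intro v hΓ
    exact Formula.realize_imp.1 (ih₁ v hΓ) (ih₂ v hΓ)
  | raa _ ih =>
    intro v hΓ
    by_contra hφ
    refine ih v ?_
    rintro ψ (rfl | hψ)
    exacts [hφ, hΓ _ hψ]
  | allI _ ih =>
    intro v hΓ
    rw [Formula.Realize, BoundedFormula.realize_all]
    intro a
    -- The new variable takes the arbitrary value `a`; the relabelled assumptions do not contain it.
    have := ih (Sum.elim v fun _ => a) (by
      rintro _ ⟨ψ, hψ, rfl⟩
      rw [Formula.realize_relabel]
      exact hΓ _ hψ)
    rw [BoundedFormula.realize_toFormula] at this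
    rw [snoc_zero]
    exact this
  | allE t _ ih =>
    intro v hΓ
    have := ih v hΓ
    rw [Formula.Realize, BoundedFormula.realize_all] at this
    rw [realize_inst]
    simpa only [snoc_zero] using this (t.realize v)
  | eqRefl t =>
    intro v _
    rw [Formula.realize_equal]
  | eqSubst φ _ _ ih₁ ih₂ =>
    intro v hΓ
    have h₁ := ih₁ v hΓ
    have h₂ := ih₂ v hΓ
    rw [Formula.realize_equal] at h₁
    rw [realize_inst] at h₂ ⊢
    rwa [← h₁]

theorem consistent_of_model {L : FirstOrder.Language} {T : L.Theory} (M : Type*) [L.Structure M]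
    (h : M ⊨ T) : Consistent T := fun hp =>
  hp.sound (M := M) default fun _ hψ => h.realize_of_mem _ hψ

end Soundness

end Skand

namespace SkandModel

open Ordinal Order

/-! ### Sequences of components -/

/-- A transfinite sequence of small subsets of `X`. -/
@[ext]
structure Sq (X : Type (u + 1)) where
  len : Ordinal.{u}
  comp : Ordinal.{u} → Set X
  small_comp : ∀ β, Small.{u} (comp β)
  comp_eq_empty : ∀ β, len ≤ β → comp β = ∅

namespace Sq

variable {X Y : Type (u + 1)}

theorem lt_len (s : Sq X) {β : Ordinal.{u}} {y : X} (h : y ∈ s.comp β) : β < s.len := by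
  by_contra hβ
  rw [s.comp_eq_empty β (not_lt.1 hβ)] at h
  exact h

/-- The sequence without its first component. -/
noncomputable def tail (s : Sq X) : Sq X where
  len := s.len - 1
  comp β := s.comp (1 + β)
  small_comp _ := s.small_comp _
  comp_eq_empty β h := s.comp_eq_empty _ (by rwa [← Ordinal.sub_le])

/-- `len - 1` is left subtraction, inverse to `1 + ·`: it removes the first position, not the last.
-/
theorem one_add_len_tail {s : Sq X} (h : 0 < s.len) : 1 + s.tail.len = s.len :=
  Ordinal.add_sub_cancel_of_le (Order.one_le_iff_pos.2 h)

/-- An infinite ordinal absorbs a 1 added on the left. The remaining length is itself infinite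
because 1 plus a finite ordinal is finite. -/
theorem len_tail_of_omega0_le {s : Sq X} (h : ω ≤ s.len) : s.tail.len = s.len := by
  have := one_add_len_tail (omega0_pos.trans_le h)
  have h' : ω ≤ s.tail.len := by
    by_contra hlt
    rw [not_le] at hlt
    have := isPrincipal_add_omega0 one_lt_omega0 hlt
    simp_all only [not_lt.2 h]
  rwa [one_add_of_omega0_le h'] at this

/-- Positivity is needed to recover the lengths, since 0 - 1 = 1 - 1 = 0. -/
theorem eq_of_tail_eq {s t : Sq X} (hs : 0 < s.len) (ht : 0 < t.len) (h₀ : s.comp 0 = t.comp 0)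
    (h : s.tail = t.tail) : s = t := by
  ext1
  · rw [← one_add_len_tail hs, ← one_add_len_tail ht, h]
  · funext β
    rcases eq_or_ne β 0 with rfl | hβ
    · exact h₀
    · rw [← Ordinal.add_sub_cancel_of_le (Order.one_le_iff_ne_zero.2 hβ)]
      exact congrFun (congrArg comp h) (β - 1)

instance small_members (s : Sq X) : Small.{u} (⋃ β : Set.Iio s.len, s.comp β) :=
  have := s.small_comp
  inferInstance

/-- Smallness of the components bounds the levels occurring in them, so that `level` is the infimum
of a nonempty set. -/
theorem exists_bound (s : Sq X) (l : X → Ordinal.{u}) :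
    ∃ o, 1 ≤ o ∧ ∀ β, ∀ y ∈ s.comp β, l y < o := by
  obtain ⟨o, ho⟩ := bddAbove_of_small (s := l '' ⋃ β : Set.Iio s.len, s.comp β)
  refine ⟨succ o, Order.one_le_iff_pos.2 (bot_le.trans_lt (lt_succ o)), fun β y hy =>
    lt_succ_of_le (ho ⟨y, ?_, rfl⟩)⟩
  exact Set.mem_iUnion.2 ⟨⟨β, s.lt_len hy⟩, hy⟩

/-- The least `o ≥ 1` such that all elements of components have level less than `o`. -/
noncomputable def level (l : X → Ordinal.{u}) (s : Sq X) : Ordinal.{u} :=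
  sInf {o | 1 ≤ o ∧ ∀ β, ∀ y ∈ s.comp β, l y < o}

theorem level_le_iff {l : X → Ordinal.{u}} {s : Sq X} {o : Ordinal.{u}} :
    s.level l ≤ o ↔ 1 ≤ o ∧ ∀ β, ∀ y ∈ s.comp β, l y < o := by
  refine ⟨fun h => ?_, fun h => csInf_le' h⟩
  obtain ⟨h₁, h₂⟩ := csInf_mem (s.exists_bound l)
  exact ⟨h₁.trans h, fun β y hy => (h₂ β y hy).trans_le h⟩

theorem one_le_level (l : X → Ordinal.{u}) (s : Sq X) : 1 ≤ s.level l :=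
  (level_le_iff.1 le_rfl).1

theorem lt_level {l : X → Ordinal.{u}} {s : Sq X} {β : Ordinal.{u}} {y : X}
    (h : y ∈ s.comp β) : l y < s.level l :=
  (level_le_iff.1 le_rfl).2 β y h

theorem level_tail_le (l : X → Ordinal.{u}) (s : Sq X) : s.tail.level l ≤ s.level l :=
  level_le_iff.2 ⟨one_le_level l s, fun _ _ hy => lt_level (s := s) hy⟩

/-- An infinite sequence is pure if its level does not drop when finitely many components are
removed. -/
def Pure (l : X → Ordinal.{u}) (s : Sq X) : Prop :=
  ω ≤ s.len ∧ ∀ n : ℕ, (tail^[n] s).level l = s.level l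

theorem Pure.pos {l : X → Ordinal.{u}} {s : Sq X} (h : s.Pure l) : 0 < s.len :=
  omega0_pos.trans_le h.1

theorem Pure.level_tail {l : X → Ordinal.{u}} {s : Sq X} (h : s.Pure l) :
    s.tail.level l = s.level l := h.2 1

theorem Pure.tail {l : X → Ordinal.{u}} {s : Sq X} (h : s.Pure l) : s.tail.Pure l := by
  refine ⟨by rw [len_tail_of_omega0_le h.1]; exact h.1, fun n => ?_⟩
  rw [h.level_tail, ← h.2 (n + 1), Function.iterate_succ_apply]

/-- The image of a sequence under a map. -/
def map (f : X → Y) (s : Sq X) : Sq Y where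
  len := s.len
  comp β := f '' s.comp β
  small_comp β := have := s.small_comp β; inferInstance
  comp_eq_empty β h := by rw [s.comp_eq_empty β h, Set.image_empty]

theorem map_injective {f : X → Y} (hf : Function.Injective f) : Function.Injective (map f) := by
  intro s t h
  ext1
  · exact congrArg (len (X := Y)) h
  · funext β
    exact hf.image_injective (congrFun (congrArg (comp (X := Y)) h) β)

theorem level_map (l : Y → Ordinal.{u}) (f : X → Y) (s : Sq X) :
    (s.map f).level l = s.level (l ∘ f) := by
  simp [level, map]

theorem pure_map {l : Y → Ordinal.{u}} {f : X → Y} {s : Sq X} :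
    (s.map f).Pure l ↔ s.Pure (l ∘ f) := by
  have : ∀ n : ℕ, tail^[n] (s.map f) = (tail^[n] s).map f := fun n =>
    (Function.Semiconj.iterate_right (f := map f) (fun _ => rfl) n s).symm
  simp only [Pure, this, level_map]
  exact Iff.rfl

end Sq

/-! ### Codes -/

theorem rank_snd_lt_rank_pair (x y : ZFSet.{u}) : y.rank < (ZFSet.pair x y).rank := by
  have h₁ : y ∈ ({x, y} : ZFSet) := by simp
  have h₂ : ({x, y} : ZFSet) ∈ ZFSet.pair x y := by simp [ZFSet.pair]
  exact (ZFSet.rank_lt_of_mem h₁).trans (ZFSet.rank_lt_of_mem h₂)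

/-- A small set of codes, as a set of the cumulative hierarchy. -/
noncomputable def toZ (S : Set ZFSet.{u}) [Small.{u} S] : ZFSet.{u} :=
  ZFSet.range (Subtype.val : S → ZFSet)

theorem mem_toZ {S : Set ZFSet.{u}} [Small.{u} S] {y : ZFSet} : y ∈ toZ S ↔ y ∈ S := by
  simp [toZ]

/-- The code of the set with the elements `S`. -/
def mkCode (S : ZFSet.{u}) : ZFSet.{u} := ZFSet.pair ∅ S

/-- The code of the skand with the sequence of components `s`. -/
noncomputable def skCode (s : Sq ZFSet.{u}) : ZFSet.{u} :=
  have := s.small_comp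
  ZFSet.pair {∅} (ZFSet.range fun β : Set.Iio s.len =>
    ZFSet.pair (toZFSet β.1) (toZ (s.comp β.1)))

theorem mkCode_injective : Function.Injective mkCode.{u} := fun _ _ h => (ZFSet.pair_inj.1 h).2

theorem mkCode_ne_skCode (S : ZFSet.{u}) (s : Sq ZFSet.{u}) : mkCode S ≠ skCode s := fun h => by
  have := (ZFSet.pair_inj.1 h).1
  have h' : (∅ : ZFSet.{u}) ∈ ({∅} : ZFSet) := by simp
  rw [← this] at h'
  exact ZFSet.notMem_empty _ h'

theorem lt_len_and_comp_eq_of_skCode_eq {s t : Sq ZFSet.{u}} (h : skCode s = skCode t) {β : Ordinal.{u}}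
    (hβ : β < s.len) : β < t.len ∧ s.comp β = t.comp β := by
  have hs := s.small_comp
  have ht := t.small_comp
  have h' := (ZFSet.pair_inj.1 h).2
  have hm := ZFSet.mem_range_self (f := fun β : Set.Iio s.len =>
    ZFSet.pair (toZFSet β.1) (toZ (s.comp β.1))) ⟨β, hβ⟩
  rw [h'] at hm
  obtain ⟨⟨γ, hγ⟩, e⟩ := ZFSet.mem_range.1 hm
  obtain ⟨e₁, e₂⟩ := ZFSet.pair_inj.1 e
  obtain rfl := toZFSet_injective e₁
  refine ⟨hγ, ?_⟩
  ext y
  rw [← mem_toZ, ← mem_toZ (S := t.comp γ)]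
  exact iff_of_eq (congrArg (y ∈ ·) e₂.symm)

theorem skCode_injective : Function.Injective skCode.{u} := by
  intro s t h
  have hlen : s.len = t.len := le_antisymm
    (le_of_forall_lt fun β hβ => (lt_len_and_comp_eq_of_skCode_eq h hβ).1)
    (le_of_forall_lt fun β hβ => (lt_len_and_comp_eq_of_skCode_eq h.symm hβ).1)
  ext1
  · exact hlen
  · funext β
    rcases lt_or_ge β s.len with hβ | hβ
    · exact (lt_len_and_comp_eq_of_skCode_eq h hβ).2
    · rw [s.comp_eq_empty β hβ, t.comp_eq_empty β (hlen ▸ hβ)]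

theorem rank_lt_rank_mkCode {S y : ZFSet.{u}} (h : y ∈ S) : y.rank < (mkCode S).rank :=
  (ZFSet.rank_lt_of_mem h).trans (rank_snd_lt_rank_pair _ _)

theorem rank_lt_rank_skCode {s : Sq ZFSet.{u}} {β : Ordinal.{u}} {y : ZFSet.{u}}
    (h : y ∈ s.comp β) : y.rank < (skCode s).rank := by
  have hs := s.small_comp
  have hm := ZFSet.mem_range_self (f := fun β : Set.Iio s.len =>
    ZFSet.pair (toZFSet β.1) (toZ (s.comp β.1))) ⟨β, s.lt_len h⟩
  exact (((ZFSet.rank_lt_of_mem (mem_toZ.2 h)).trans (rank_snd_lt_rank_pair _ _)).trans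
    (ZFSet.rank_lt_of_mem hm)).trans (rank_snd_lt_rank_pair _ _)

/-- The level of a code: the least `o` such that the object coded belongs to `V^(o)`. -/
noncomputable def codeLevel (x : ZFSet.{u}) : Ordinal.{u} :=
  sInf {o | (∀ (S : ZFSet.{u}) (_ : x = mkCode S) (y : ZFSet.{u}) (_ : y ∈ S), codeLevel y ≤ o) ∧
    ∀ (s : Sq ZFSet.{u}) (_ : x = skCode s), 1 ≤ o ∧
      ∀ (β : Ordinal.{u}) (y : ZFSet.{u}) (_ : y ∈ s.comp β), codeLevel y < o}
termination_by x.rank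
decreasing_by
  · subst x; exact rank_lt_rank_mkCode ‹_›
  · subst x; exact rank_lt_rank_skCode ‹_›

theorem codeLevel_mkCode_le_iff {S : ZFSet.{u}} {o : Ordinal.{u}} :
    codeLevel (mkCode S) ≤ o ↔ ∀ y ∈ S, codeLevel y ≤ o := by
  rw [codeLevel]
  have h : {o | (∀ (S' : ZFSet.{u}) (_ : mkCode S = mkCode S') (y : ZFSet.{u}) (_ : y ∈ S'),
      codeLevel y ≤ o) ∧ ∀ (s : Sq ZFSet.{u}) (_ : mkCode S = skCode s), 1 ≤ o ∧
      ∀ (β : Ordinal.{u}) (y : ZFSet.{u}) (_ : y ∈ s.comp β), codeLevel y < o} =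
      {o | ∀ y ∈ S, codeLevel y ≤ o} := by
    ext o
    refine ⟨fun h => h.1 S rfl, fun h => ⟨fun S' e => ?_, fun s e => (mkCode_ne_skCode _ _ e).elim⟩⟩
    obtain rfl := mkCode_injective e
    exact h
  rw [h]
  refine ⟨fun h y hy => ?_, fun h => csInf_le' h⟩
  have := ZFSet.small_coe S
  have : Small.{u} (S : Set ZFSet.{u}) := this
  obtain ⟨b, hb⟩ := bddAbove_of_small (s := codeLevel '' (S : Set ZFSet.{u}))
  exact (csInf_mem (s := {o | ∀ y ∈ S, codeLevel y ≤ o})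
    ⟨b, fun y hy => hb ⟨y, hy, rfl⟩⟩ y hy).trans h

theorem codeLevel_skCode (s : Sq ZFSet.{u}) : codeLevel (skCode s) = s.level codeLevel := by
  rw [codeLevel, Sq.level]
  congr 1
  ext o
  refine ⟨fun h => h.2 s rfl, fun h => ⟨fun S e => (mkCode_ne_skCode _ _ e.symm).elim,
    fun t e => ?_⟩⟩
  obtain rfl := skCode_injective e
  exact h

/-- The set of the elements of the pure skand with the sequence of components `s`. -/
def skElements (s : Sq ZFSet.{u}) : Set ZFSet.{u} := insert (skCode s.tail) (s.comp 0)

/-- The tail of a pure sequence has the level of the sequence, while the elements of the first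
component lie strictly below. So the common level is the greatest one that occurs, the tail is the
unique element attaining it, and what is left is the first component. -/
theorem skElements_injOn : Set.InjOn skElements {s : Sq ZFSet.{u} | s.Pure codeLevel} := by
  have key : ∀ {s t : Sq ZFSet.{u}}, s.Pure codeLevel → t.Pure codeLevel →
      skElements s = skElements t → s.level codeLevel ≤ t.level codeLevel := by
    intro s t hs ht h
    have hm : skCode s.tail ∈ skElements t := h ▸ Set.mem_insert _ _
    rw [← hs.level_tail, ← codeLevel_skCode]
    rcases hm with e | hm
    · rw [e, codeLevel_skCode, ht.level_tail]
    · exact (Sq.lt_level hm).le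
  have notMem : ∀ {s : Sq ZFSet.{u}} {y}, s.Pure codeLevel → y ∈ s.comp 0 →
      codeLevel y ≠ s.level codeLevel := fun _ hy => (Sq.lt_level hy).ne
  intro s hs t ht h
  have hl := le_antisymm (key hs ht h) (key ht hs h.symm)
  have hcs : codeLevel (skCode s.tail) = s.level codeLevel := by
    rw [codeLevel_skCode, Sq.Pure.level_tail hs]
  have hct : codeLevel (skCode t.tail) = t.level codeLevel := by
    rw [codeLevel_skCode, Sq.Pure.level_tail ht]
  have htail : skCode s.tail = skCode t.tail := by
    have hm : skCode s.tail ∈ skElements t := h ▸ Set.mem_insert _ _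
    exact hm.resolve_right fun hm => notMem ht hm (hcs.trans hl)
  refine Sq.eq_of_tail_eq (Sq.Pure.pos hs) (Sq.Pure.pos ht) ?_ (skCode_injective htail)
  have e₁ : s.comp 0 = skElements s \ {skCode s.tail} := by
    rw [skElements, Set.insert_sdiff_self_of_notMem fun hm => notMem hs hm hcs]
  have e₂ : t.comp 0 = skElements t \ {skCode t.tail} := by
    rw [skElements, Set.insert_sdiff_self_of_notMem fun hm => notMem ht hm hct]
  rw [e₁, e₂, h, htail]

/-- The codes of the objects of the model: the codes of the pure skands, and the codes of the sets
that do not have the elements of a pure skand. -/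
inductive IsCode : ZFSet.{u} → Prop
  | mk (S : ZFSet.{u}) : (∀ y ∈ S, IsCode y) →
      (∀ s : Sq ZFSet.{u}, s.Pure codeLevel → (S : Set ZFSet.{u}) ≠ skElements s) →
      IsCode (mkCode S)
  | sk (s : Sq ZFSet.{u}) : s.Pure codeLevel → (∀ β, ∀ y ∈ s.comp β, IsCode y) →
      IsCode (skCode s)

/-! ### The universe of sets -/

/-- The sets of the model. -/
structure E : Type (u + 1) where
  code : ZFSet.{u}
  isCode : IsCode code

namespace E

theorem code_injective : Function.Injective code.{u} := by
  rintro ⟨x, hx⟩ ⟨y, hy⟩ h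
  congr

/-- The level of a set: the least `o` such that the set belongs to `V^(o)`. -/
noncomputable def level (e : E.{u}) : Ordinal.{u} := codeLevel e.1

/-- The set of the elements of a set. -/
def elems (e : E.{u}) : Set E.{u} :=
  {y | (∃ S : ZFSet.{u}, e.1 = mkCode S ∧ y.1 ∈ S) ∨
    ∃ s : Sq ZFSet.{u}, e.1 = skCode s ∧ y.1 ∈ skElements s}

/-- The skand with the pure sequence of components `s`. -/
noncomputable def sk (s : Sq E.{u}) (h : s.Pure level) : E.{u} :=
  ⟨skCode (s.map code), .sk _ (Sq.pure_map.2 h) (by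
    rintro β _ ⟨y, -, rfl⟩
    exact y.2)⟩

theorem sk_inj {s t : Sq E.{u}} {hs : s.Pure level} {ht : t.Pure level} :
    sk s hs = sk t ht ↔ s = t := by
  refine ⟨fun h => ?_, fun h => by subst h; rfl⟩
  exact Sq.map_injective code_injective (skCode_injective (congrArg code h))

theorem elems_sk (s : Sq E.{u}) (h : s.Pure level) :
    (sk s h).elems = insert (sk s.tail h.tail) (s.comp 0) := by
  ext y
  constructor
  · rintro (⟨S, e, -⟩ | ⟨t, e, hy⟩)
    · exact (mkCode_ne_skCode _ _ e.symm).elim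
    · obtain rfl := skCode_injective e
      rcases hy with hy | ⟨z, hz, hy⟩
      · exact Or.inl (code_injective hy)
      · obtain rfl := code_injective hy
        exact Or.inr hz
  · rintro (rfl | hy)
    · exact Or.inr ⟨_, rfl, Or.inl rfl⟩
    · exact Or.inr ⟨_, rfl, Or.inr ⟨y, hy, rfl⟩⟩

theorem level_sk (s : Sq E.{u}) (h : s.Pure level) : (sk s h).level = s.level level := by
  rw [level, sk, codeLevel_skCode, Sq.level_map]
  rfl

theorem exists_map_eq {t : Sq ZFSet.{u}} (h : ∀ β, ∀ y ∈ t.comp β, IsCode y) :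
    ∃ s : Sq E.{u}, s.map code = t := by
  refine ⟨⟨t.len, fun β => {y | y.1 ∈ t.comp β}, fun β => ?_, fun β hβ => ?_⟩, ?_⟩
  · have := t.small_comp β
    exact small_of_injective (f := fun y : {y : E.{u} | y.1 ∈ t.comp β} =>
      (⟨y.1.1, y.2⟩ : t.comp β)) fun y z e => Subtype.ext (code_injective (Subtype.mk.inj e))
  · rw [t.comp_eq_empty β hβ]
    rfl
  · ext1
    · rfl
    · funext β
      ext y
      exact ⟨fun ⟨z, hz, e⟩ => e ▸ hz, fun hy => ⟨⟨y, h β y hy⟩, hy, rfl⟩⟩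

/-- Every set is a pure skand, or all its elements have smaller codes. -/
theorem cases (e : E.{u}) : (∃ s h, e = sk s h) ∨
    (∀ y ∈ e.elems, y.1.rank < e.1.rank) ∧ (∀ o, e.level ≤ o ↔ ∀ y ∈ e.elems, y.level ≤ o) ∧
      ∃ S : ZFSet.{u}, e.1 = mkCode S ∧ code '' e.elems = (S : Set ZFSet.{u}) := by
  obtain ⟨x, hx⟩ := e
  rcases hx with ⟨S, hS, hns⟩ | ⟨t, hp, ht⟩
  · right
    have hext : ∀ y : E.{u}, y ∈ elems ⟨mkCode S, .mk S hS hns⟩ ↔ y.1 ∈ S := by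
      refine fun y => ⟨?_, fun hy => Or.inl ⟨S, rfl, hy⟩⟩
      rintro (⟨T, e, hy⟩ | ⟨t, e, -⟩)
      · rwa [mkCode_injective e]
      · exact (mkCode_ne_skCode _ _ e).elim
    refine ⟨fun y hy => rank_lt_rank_mkCode ((hext y).1 hy), fun o => ?_, S, rfl, ?_⟩
    · rw [level, codeLevel_mkCode_le_iff]
      exact ⟨fun h y hy => h _ ((hext y).1 hy), fun h y hy => h ⟨y, hS y hy⟩ ((hext _).2 hy)⟩
    · ext y
      refine ⟨?_, fun hy => ⟨⟨y, hS y hy⟩, (hext _).2 hy, rfl⟩⟩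
      rintro ⟨z, hz, rfl⟩
      exact (hext z).1 hz
  · left
    obtain ⟨s, rfl⟩ := exists_map_eq ht
    exact ⟨s, Sq.pure_map.1 hp, rfl⟩

theorem image_elems_sk (s : Sq E.{u}) (h : s.Pure level) :
    code '' (sk s h).elems = skElements (s.map code) := by
  rw [elems_sk, Set.image_insert_eq]
  rfl

/-- The exclusion clause of `IsCode.mk`, recovered by inversion: no set has both an ordinary code
and a skand code. -/
theorem mk_code_ne {e : E.{u}} {S : ZFSet.{u}} (he : e.1 = mkCode S) {t : Sq ZFSet.{u}}
    (ht : t.Pure codeLevel) : (S : Set ZFSet.{u}) ≠ skElements t := by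
  have hx := e.isCode
  rw [he] at hx
  generalize hc : mkCode S = x at hx
  rcases hx with ⟨T, -, hns⟩ | ⟨t, -, -⟩
  · obtain rfl := mkCode_injective hc
    exact hns t ht
  · exact (mkCode_ne_skCode _ _ hc).elim

/-- Extensionality. Two pure skands are compared by `skElements_injOn`, two ordinary sets by their
codes, and the mixed cases are excluded by `mk_code_ne`. -/
theorem elems_injective : Function.Injective elems.{u} := by
  intro d e h
  rcases d.cases with ⟨s, hs, rfl⟩ | ⟨-, -, S, hd, hS⟩ <;>
  rcases e.cases with ⟨t, ht, rfl⟩ | ⟨-, -, T, he, hT⟩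
  · have := congrArg (code '' ·) h
    simp only [image_elems_sk] at this
    rw [sk_inj]
    exact Sq.map_injective code_injective
      (skElements_injOn (Sq.pure_map.2 hs) (Sq.pure_map.2 ht) this)
  · rw [← h, image_elems_sk] at hT
    exact (mk_code_ne he (Sq.pure_map.2 hs) hT.symm).elim
  · rw [h, image_elems_sk] at hS
    exact (mk_code_ne hd (Sq.pure_map.2 ht) hS.symm).elim
  · rw [h, hT] at hS
    exact code_injective (by rw [hd, he, SetLike.coe_injective hS])

instance small_elems (e : E.{u}) : Small.{u} e.elems := by
  rcases e.cases with ⟨s, hs, rfl⟩ | ⟨-, -, S, hd, hS⟩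
  · rw [elems_sk]
    have := s.small_comp 0
    infer_instance
  · have : Small.{u} (code '' e.elems : Set ZFSet.{u}) := by
      rw [hS]
      exact ZFSet.small_coe S
    exact small_of_injective (f := fun y : e.elems =>
      (⟨code y.1, y.1, y.2, rfl⟩ : code '' e.elems))
      fun y z h => Subtype.ext (code_injective (Subtype.mk.inj h))

/-- An ordinary code does the job unless it is forbidden; then the given elements are those of a
pure skand, which serves instead. -/
theorem exists_elems_eq (S : Set E.{u}) [Small.{u} S] : ∃ e : E.{u}, e.elems = S := by
  by_cases h : ∃ t : Sq ZFSet.{u}, t.Pure codeLevel ∧ code '' S = skElements t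
  · obtain ⟨t, ht, e⟩ := h
    have hm : ∀ y ∈ skElements t, IsCode y := by
      rw [← e]
      rintro _ ⟨y, -, rfl⟩
      exact y.2
    have hm' : ∀ β, ∀ y ∈ t.comp β, IsCode y := by
      intro β y hy
      rcases eq_or_ne β 0 with rfl | hβ
      · exact hm y (Or.inr hy)
      -- Components after the first are components of the tail, whose code is among the given
      -- elements and is therefore legitimate.
      · have h₁ := hm (skCode t.tail) (Or.inl rfl)
        generalize hx : skCode t.tail = x at h₁
        rcases h₁ with ⟨T, -, -⟩ | ⟨t', -, ht'⟩
        · exact (mkCode_ne_skCode _ _ hx.symm).elim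
        · obtain rfl := skCode_injective hx
          rw [← Ordinal.add_sub_cancel_of_le (Order.one_le_iff_ne_zero.2 hβ)] at hy
          exact ht' _ y hy
    obtain ⟨s, rfl⟩ := exists_map_eq hm'
    refine ⟨sk s (Sq.pure_map.1 ht), code_injective.image_injective ?_⟩
    exact (image_elems_sk s _).trans e.symm
  · refine ⟨⟨mkCode (toZ (code '' S)), .mk _ (fun y hy => ?_) fun t ht e => ?_⟩, ?_⟩
    · obtain ⟨z, -, rfl⟩ := mem_toZ.1 hy
      exact z.2
    · refine h ⟨t, ht, ?_⟩
      rw [← e]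
      ext y
      exact mem_toZ.symm
    · ext y
      constructor
      · rintro (⟨T, e, hy⟩ | ⟨t, e, -⟩)
        · obtain rfl := mkCode_injective e
          obtain ⟨z, hz, e⟩ := mem_toZ.1 hy
          rwa [← code_injective e]
        · exact (mkCode_ne_skCode _ _ e).elim
      · exact fun hy => Or.inl ⟨_, rfl, mem_toZ.2 ⟨y, hy, rfl⟩⟩

/-- For a pure skand the bound comes from its tail, an element of the same level. This is where
purity makes the levels closed under forming sets. -/
theorem level_le_of_forall {e : E.{u}} {o : Ordinal.{u}} (h : ∀ y ∈ e.elems, y.level ≤ o) :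
    e.level ≤ o := by
  rcases e.cases with ⟨s, hs, rfl⟩ | ⟨-, hl, -⟩
  · rw [level_sk, ← hs.level_tail, ← level_sk _ hs.tail]
    exact h _ (by rw [elems_sk]; exact Or.inl rfl)
  · exact (hl o).2 h

theorem level_le_of_mem {e y : E.{u}} (h : y ∈ e.elems) : y.level ≤ e.level := by
  rcases e.cases with ⟨s, hs, rfl⟩ | ⟨-, hl, -⟩
  · rw [level_sk]
    rw [elems_sk] at h
    rcases h with rfl | h
    · rw [level_sk, hs.level_tail]
    · exact (Sq.lt_level h).le
  · exact (hl _).1 le_rfl y h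

/-- The induction principle of the model. -/
theorem induction {P : E.{u} → Prop} (mk : ∀ e, (∀ y ∈ e.elems, P y) → P e)
    (sk : ∀ s h, (∀ β, ∀ y ∈ s.comp β, P y) → P (sk s h)) (e : E.{u}) : P e := by
  induction hr : e.1.rank using WellFoundedLT.induction generalizing e with
  | ind r ih =>
    subst hr
    rcases e.cases with ⟨s, hs, rfl⟩ | ⟨hlt, -, -⟩
    · exact sk s hs fun β y hy => ih _ (rank_lt_rank_skCode (s := s.map code) (Set.mem_image_of_mem code hy)) _ rfl
    · exact mk e fun y hy => ih _ (hlt y hy) _ rfl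

end E

/-! ### Generalized skands -/

/-- `Gives s e` means that `e` is the generalized skand with the sequence of components `s`. -/
inductive Gives : Sq E.{u} → E.{u} → Prop
  | pure (s : Sq E.{u}) (h : s.Pure E.level) : Gives s (E.sk s h)
  | single (s : Sq E.{u}) (e : E.{u}) : s.len = 1 → e.elems = s.comp 0 → Gives s e
  | cons (s : Sq E.{u}) (e y : E.{u}) : ¬ s.Pure E.level → 1 < s.len → Gives s.tail y →
      e.elems = insert y (s.comp 0) → Gives s e

/-! ### Reaching a pure sequence by finitely many removals -/

namespace Sq

variable {X : Type (u + 1)}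

theorem len_tail_le (s : Sq X) : s.tail.len ≤ s.len := Ordinal.sub_le_self _ _

theorem len_iterate_tail_le (n : ℕ) (s : Sq X) : (tail^[n] s).len ≤ s.len := by
  induction n generalizing s with
  | zero => exact le_rfl
  | succ n ih => exact (ih s.tail).trans s.len_tail_le

theorem omega0_le_len_iterate_tail {s : Sq X} (h : ω ≤ s.len) (n : ℕ) :
    ω ≤ (tail^[n] s).len := by
  induction n generalizing s with
  | zero => exact h
  | succ n ih => exact ih (by rwa [len_tail_of_omega0_le h])

theorem level_iterate_tail_le (l : X → Ordinal.{u}) (n : ℕ) (s : Sq X) :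
    (tail^[n] s).level l ≤ s.level l := by
  induction n generalizing s with
  | zero => exact le_rfl
  | succ n ih => exact (ih s.tail).trans (level_tail_le l s)

/-- The levels of the successive tails decrease weakly; at a tail of least level no further drop is
possible. -/
theorem exists_pure_iterate_tail (l : X → Ordinal.{u}) {s : Sq X} (h : ω ≤ s.len) :
    ∃ n : ℕ, (tail^[n] s).Pure l := by
  obtain ⟨n, hn⟩ := csInf_mem (Set.range_nonempty fun n : ℕ => (tail^[n] s).level l)
  refine ⟨n, omega0_le_len_iterate_tail h n, fun m => le_antisymm (level_iterate_tail_le l m _) ?_⟩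
  simp only at hn
  rw [hn, ← Function.iterate_add_apply]
  exact csInf_le' ⟨m + n, rfl⟩

/-- Consequently, if a tail is pure and the sequence is not, the level has dropped strictly. -/
theorem Pure.of_tail {l : X → Ordinal.{u}} {s : Sq X} (h : s.tail.Pure l)
    (hl : s.tail.level l = s.level l) : s.Pure l := by
  refine ⟨h.1.trans s.len_tail_le, fun n => ?_⟩
  cases n with
  | zero => rfl
  | succ n => exact (h.2 n).trans hl

theorem len_tail_pos {s : Sq X} (h : 1 < s.len) : 0 < s.tail.len := by
  rw [tail, Ordinal.lt_sub]
  simpa using h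

end Sq

/-! ### Existence, uniqueness, elements and levels of skands -/

namespace Gives

theorem pos {s : Sq E.{u}} {e : E.{u}} (h : Gives s e) : 0 < s.len := by
  cases h with
  | pure _ h => exact h.pos
  | single _ _ h => rw [h]; exact zero_lt_one
  | cons _ _ _ _ h => exact zero_lt_one.trans h

theorem exists_insert (y : E.{u}) (s : Sq E.{u}) : ∃ e : E.{u}, e.elems = insert y (s.comp 0) :=
  have := s.small_comp 0
  E.exists_elems_eq _

theorem exists_of_pure_iterate (n : ℕ) {s : Sq E.{u}} (h : (Sq.tail^[n] s).Pure E.level) :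
    ∃ e, Gives s e := by
  induction n generalizing s with
  | zero => exact ⟨_, pure s h⟩
  | succ n ih =>
    by_cases hs : s.Pure E.level
    · exact ⟨_, pure s hs⟩
    · obtain ⟨y, hy⟩ := ih (s := s.tail) h
      obtain ⟨e, he⟩ := exists_insert y s
      exact ⟨e, cons s e y hs
        (one_lt_omega0.trans_le (h.1.trans (Sq.len_iterate_tail_le (n + 1) s))) hy he⟩

/-- The length is written `1 + n` because passing to the tail cancels a 1 on the left. -/
theorem exists_of_finite (n : ℕ) {s : Sq E.{u}} (h : s.len = 1 + n) : ∃ e, Gives s e := by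
  induction n generalizing s with
  | zero =>
    have := s.small_comp 0
    obtain ⟨e, he⟩ := E.exists_elems_eq (s.comp 0)
    exact ⟨e, single s e (by simpa using h) he⟩
  | succ n ih =>
    have h' : s.len = 1 + (1 + n) := by
      rw [h]
      exact_mod_cast (by omega : 1 + (n + 1) = 1 + (1 + n))
    obtain ⟨y, hy⟩ := ih (s := s.tail) (by
      change s.len - 1 = 1 + n
      rw [h', Ordinal.add_sub_cancel])
    obtain ⟨e, he⟩ := exists_insert y s
    refine ⟨e, cons s e y (fun hp => ?_) ?_ hy he⟩
    · refine hp.1.not_gt ?_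
      rw [h]
      exact_mod_cast natCast_lt_omega0 (1 + (n + 1))
    · rw [h]
      exact_mod_cast (by omega : 1 < 1 + (n + 1))

theorem exists_of_pos {s : Sq E.{u}} (h : 0 < s.len) : ∃ e, Gives s e := by
  rcases lt_or_ge s.len ω with hf | hi
  · obtain ⟨n, hn⟩ := lt_omega0.1 hf
    obtain ⟨m, rfl⟩ : ∃ m, n = 1 + m := by
      refine Nat.exists_eq_add_of_le ?_
      rw [hn] at h
      exact_mod_cast h
    exact exists_of_finite m (by rw [hn]; norm_cast)
  · obtain ⟨n, hn⟩ := Sq.exists_pure_iterate_tail E.level hi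
    exact exists_of_pure_iterate n hn

theorem not_pure_of_len_eq_one {s : Sq E.{u}} (h : s.len = 1) : ¬ s.Pure E.level := fun hp =>
  (one_lt_omega0.trans_le hp.1).ne' h

/-- The three clauses exclude one another: pure sequences are infinite, and `cons` requires more
than one component and no purity. Within a clause, extensionality decides. -/
theorem unique {s : Sq E.{u}} {d e : E.{u}} (hd : Gives s d) (he : Gives s e) : d = e := by
  induction hd generalizing e with
  | pure s hs =>
    cases he with
    | pure => rfl
    | single _ _ h => exact (not_pure_of_len_eq_one h hs).elim
    | cons _ _ _ h => exact (h hs).elim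
  | single s d h hd =>
    cases he with
    | pure _ hs => exact (not_pure_of_len_eq_one h hs).elim
    | single _ _ _ he => exact E.elems_injective (hd.trans he.symm)
    | cons _ _ _ _ h' => exact (h'.ne' h).elim
  | cons s d y h h' _ hd ih =>
    cases he with
    | pure _ hs => exact (h hs).elim
    | single _ _ h => exact (h'.ne' h).elim
    | cons _ _ z _ _ hz he =>
      rw [← ih hz] at he
      exact E.elems_injective (hd.trans he.symm)

theorem mem_elems_iff {s : Sq E.{u}} {e : E.{u}} (h : Gives s e) (z : E.{u}) :
    z ∈ e.elems ↔ z ∈ s.comp 0 ∨ 1 < s.len ∧ Gives s.tail z := by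
  cases h with
  | pure _ hs =>
    rw [E.elems_sk, Set.mem_insert_iff, or_comm]
    refine or_congr_right ⟨?_, fun h => h.2.unique (pure _ hs.tail)⟩
    rintro rfl
    exact ⟨one_lt_omega0.trans_le hs.1, pure _ _⟩
  | single _ _ h he =>
    rw [he, h]
    simp
  | cons _ _ y _ h hy he =>
    rw [he, Set.mem_insert_iff, or_comm]
    refine or_congr_right ⟨?_, fun h => h.2.unique hy⟩
    rintro rfl
    exact ⟨h, hy⟩

theorem level_le {s : Sq E.{u}} {e : E.{u}} (h : Gives s e) : e.level ≤ s.level E.level := by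
  induction h with
  | pure s h => exact (E.level_sk s h).le
  | single s e _ he =>
    exact E.level_le_of_forall fun y hy => (Sq.lt_level (he ▸ hy)).le
  | cons s e y _ _ _ he ih =>
    refine E.level_le_of_forall fun z hz => ?_
    rw [he] at hz
    rcases hz with rfl | hz
    · exact ih.trans (Sq.level_tail_le _ s)
    · exact (Sq.lt_level hz).le

/-- A skand of level at most `o` that is not pure of level `o` belongs to every class that contains
the sets of level less than `o` and every set of its members. -/
theorem mem_or_pure {s : Sq E.{u}} {e : E.{u}} (h : Gives s e) {o : Ordinal.{u}}
    (hs : s.level E.level ≤ o) {K : Set E.{u}} (hK₁ : ∀ y : E.{u}, y.level < o → y ∈ K)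
    (hK₂ : ∀ y : E.{u}, y.elems ⊆ K → y ∈ K) :
    e ∈ K ∨ s.Pure E.level ∧ s.level E.level = o := by
  induction h with
  | pure s h =>
    rcases hs.lt_or_eq with hlt | heq
    · exact Or.inl (hK₁ _ ((E.level_sk s h).trans_lt hlt))
    · exact Or.inr ⟨h, heq⟩
  | single s e _ he =>
    refine Or.inl (hK₂ _ fun y hy => hK₁ y ?_)
    rw [he] at hy
    exact (Sq.lt_level hy).trans_le hs
  | cons s e y hn _ _ he ih =>
    rcases ih ((Sq.level_tail_le _ s).trans hs) with hy | ⟨hp, hl⟩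
    · refine Or.inl (hK₂ _ fun z hz => ?_)
      rw [he] at hz
      rcases hz with rfl | hz
      · exact hy
      · exact hK₁ z ((Sq.lt_level hz).trans_le hs)
    -- If the tail is pure of level `o`, the whole sequence, being of level at most `o`, has not
    -- lost level and is pure too, contrary to `cons`.
    · refine (hn (hp.of_tail (le_antisymm (Sq.level_tail_le _ s) ?_))).elim
      rwa [hl]

theorem eq_of_pure {s t : Sq E.{u}} {e : E.{u}} (hs : Gives s e) (ht : Gives t e)
    (hs' : s.Pure E.level) (ht' : t.Pure E.level) : s = t :=
  E.sk_inj.1 (((pure s hs').unique hs).trans (ht.unique (pure t ht')))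

end Gives

/-- The sets of level at most `o` are generated by the sets of smaller level and the skands. -/
theorem E.mem_of_level_le {e : E.{u}} {o : Ordinal.{u}} (he : e.level ≤ o) {K : Set E.{u}}
    (hK₂ : ∀ y : E.{u}, y.elems ⊆ K → y ∈ K)
    (hK₃ : ∀ s y, Gives s y → s.level E.level ≤ o → y ∈ K) : e ∈ K := by
  induction e using E.induction with
  | mk e ih => exact hK₂ _ fun y hy => ih y hy ((E.level_le_of_mem hy).trans he)
  | sk s h _ => exact hK₃ s _ (.pure s h) ((E.level_sk s h).ge.trans he)

/-! ### Pairs and ordinals -/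

namespace E

/-- The set with the elements `S`. -/
noncomputable def of (S : Set E.{u}) [Small.{u} S] : E.{u} := (exists_elems_eq S).choose

@[simp]
theorem elems_of (S : Set E.{u}) [Small.{u} S] : (of S).elems = S := (exists_elems_eq S).choose_spec

@[simp]
theorem elems_inj {d e : E.{u}} : d.elems = e.elems ↔ d = e := elems_injective.eq_iff

noncomputable def upair (x y : E.{u}) : E.{u} := of {x, y}

@[simp]
theorem elems_upair (x y : E.{u}) : (upair x y).elems = {x, y} := elems_of _

noncomputable def pair (x y : E.{u}) : E.{u} := upair (upair x x) (upair x y)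

theorem upair_inj {x y z w : E.{u}} :
    upair x y = upair z w ↔ x = z ∧ y = w ∨ x = w ∧ y = z := by
  rw [← elems_inj, elems_upair, elems_upair, Set.pair_eq_pair_iff]

theorem pair_inj {x y z w : E.{u}} : pair x y = pair z w ↔ x = z ∧ y = w := by
  simp only [pair, upair_inj]
  grind

/-- The von Neumann ordinals of the model. -/
noncomputable def ord (o : Ordinal.{u}) : E.{u} := of (Set.range fun p : Set.Iio o => ord p.1)
termination_by o
decreasing_by exact p.2

theorem mem_elems_ord {o : Ordinal.{u}} {x : E.{u}} : x ∈ (ord o).elems ↔ ∃ p < o, ord p = x := by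
  rw [ord, elems_of]
  simp

/-- Membership in `E` may be ill-founded, so the induction runs over the indices: if `ord p = ord o`
with `p < o`, then `ord p` is an element of itself and hence equals some `ord q` with `q < p`. -/
theorem ord_injective : Function.Injective ord.{u} := by
  have key : ∀ p o : Ordinal.{u}, p < o → ord p ≠ ord o := by
    intro p
    induction p using WellFoundedLT.induction with
    | ind p ih =>
      intro o hpo h
      have hm : ord p ∈ (ord o).elems := mem_elems_ord.2 ⟨p, hpo, rfl⟩
      rw [← h] at hm
      obtain ⟨q, hq, e⟩ := mem_elems_ord.1 hm
      exact ih q hq p hq e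
  intro p o h
  rcases lt_trichotomy p o with hlt | heq | hlt
  exacts [(key p o hlt h).elim, heq, (key o p hlt h.symm).elim]

@[simp]
theorem ord_inj {p o : Ordinal.{u}} : ord p = ord o ↔ p = o := ord_injective.eq_iff

@[simp]
theorem ord_mem_elems_ord {p o : Ordinal.{u}} : ord p ∈ (ord o).elems ↔ p < o := by
  rw [mem_elems_ord]
  simp

/-- A transitive set that is well-ordered by membership is a von Neumann ordinal. -/
theorem exists_ord_eq {a : E.{u}} (h₁ : ∀ x ∈ a.elems, x.elems ⊆ a.elems)
    (h₂ : ∀ x ∈ a.elems, ∀ y ∈ a.elems, x ∈ y.elems ∨ x = y ∨ y ∈ x.elems)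
    (h₃ : ∀ s : E.{u}, s.elems ⊆ a.elems → s.elems.Nonempty →
      ∃ m ∈ s.elems, ∀ x ∈ s.elems, x ∉ m.elems) : ∃ o, ord o = a := by
  -- The elements of `a` form a small set and the ordinals do not, so some ordinal is missing; `o`
  -- will be the least one.
  have hne : {o | ord o ∉ a.elems}.Nonempty := by
    by_contra hall
    rw [Set.not_nonempty_iff_eq_empty, Set.eq_empty_iff_forall_notMem] at hall
    simp only [Set.mem_ofPred_eq, not_not] at hall
    exact not_small_ordinal.{u, u} (small_of_injective (f := fun o => (⟨ord o, hall o⟩ : a.elems))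
      fun p o h => ord_injective (Subtype.mk.inj h))
  have ho : ord (sInf {o | ord o ∉ a.elems}) ∉ a.elems := csInf_mem hne
  have hlt : ∀ p < sInf {o | ord o ∉ a.elems}, ord p ∈ a.elems := fun p hp => by
    by_contra hpa
    exact hp.not_ge (csInf_le' hpa)
  generalize sInf {o | ord o ∉ a.elems} = o at ho hlt
  refine ⟨o, elems_injective (Set.Subset.antisymm ?_ ?_)⟩
  · intro x hx
    obtain ⟨p, hp, rfl⟩ := mem_elems_ord.1 hx
    exact hlt p hp
  · by_contra hsub
    obtain ⟨x, hxa, hxo⟩ := Set.not_subset.1 hsub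
    -- A minimal element of `a` outside `ord o` turns out to be `ord o` itself, which is not in `a`.
    obtain ⟨m, hm, hmin⟩ := h₃ (of (a.elems \ (ord o).elems)) (by simp)
      ⟨x, by simpa using ⟨hxa, hxo⟩⟩
    simp only [elems_of, Set.mem_sdiff] at hm hmin
    refine ho ?_
    suffices m = ord o from this ▸ hm.1
    refine elems_injective (Set.Subset.antisymm (fun y hy => ?_) fun y hy => ?_)
    · by_contra hyo
      exact hmin y ⟨h₁ m hm.1 hy, hyo⟩ hy
    · obtain ⟨p, hp, rfl⟩ := mem_elems_ord.1 hy
      rcases h₂ _ (hlt p hp) m hm.1 with h | h | h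
      · exact h
      · exact (hm.2 (h ▸ hy)).elim
      · obtain ⟨q, hq, rfl⟩ := mem_elems_ord.1 h
        exact (hm.2 (ord_mem_elems_ord.2 (hq.trans hp))).elim

open Cardinal in
-- Codes of rank `o` lie in a stage of the cumulative hierarchy, which is small and so can be
-- well-ordered in an ordinal of the same universe. Rank and position within the layer inject `E`
-- into pairs of ordinals, of which there are as many as ordinals.
theorem nonempty_equiv_ordinal : Nonempty (E.{u} ≃ Ordinal.{u}) := by
  rw [← Cardinal.eq]
  refine le_antisymm ?_ (mk_le_of_injective ord_injective)
  have hinj : ∀ o : Ordinal.{u}, ∃ f : ZFSet.{u} → Ordinal.{u},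
      ∀ x y, x.rank = o → y.rank = o → f x = f y → x = y := fun o => by
    have hV : ∀ x : ZFSet.{u}, x.rank = o → x ∈ ZFSet.vonNeumann (succ o) := fun x hx =>
      ZFSet.mem_vonNeumann.2 (hx ▸ lt_succ _)
    classical
    refine ⟨fun x => if h : x.rank = o then
      typein (WellOrderingRel (α := Shrink.{u} (ZFSet.vonNeumann (succ o))))
        (equivShrink _ ⟨x, hV x h⟩) else 0, fun x y hx hy h => ?_⟩
    simp only [hx, hy, dite_true] at h
    exact Subtype.mk.inj ((equivShrink _).injective (typein_injective _ h))
  choose f hf using hinj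
  have : Function.Injective fun e : E.{u} => (e.code.rank, f e.code.rank e.code) := by
    intro d e h
    obtain ⟨h₁, h₂⟩ := Prod.mk.inj h
    rw [h₁] at h₂
    exact code_injective (hf _ _ _ h₁ rfl h₂)
  refine (mk_le_of_injective this).trans ?_
  rw [mk_prod, Cardinal.lift_id]
  exact (mul_eq_self (aleph0_le_mk _)).le

end E

/-! ### The model -/

/-- Membership of classes: `X` is a set that belongs to `Y`. -/
def Mem (X Y : Set E.{u}) : Prop := ∃ e : E.{u}, e.elems = X ∧ e ∈ Y

/-- `f` is the sequence of components `s`, with the indices starting at `a`. -/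
def Codes (f : E.{u}) (a : Ordinal.{u}) (s : Sq E.{u}) : Prop :=
  0 < s.len ∧
    f.elems = {p | ∃ β < s.len, ∃ y : E.{u}, y.elems = s.comp β ∧ E.pair (E.ord (a + β)) y = p}

/-- The class `X` is the skand with the sequence of components `F`. -/
def IsSkandOf (F X : Set E.{u}) : Prop :=
  ∃ f a s e, E.elems f = F ∧ E.elems e = X ∧ Codes f a s ∧ Gives s e

/-- The class `N` is an ordinal `o`, and `X` is a set of level at most `o`. -/
def HasLevel (N X : Set E.{u}) : Prop :=
  ∃ o e, (E.ord o).elems = N ∧ E.elems e = X ∧ e.level ≤ o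

/-- The model: its objects are all classes of sets, and there are no individuals. -/
noncomputable instance : Skand.Lang.{u}.Structure (Set E.{u}) where
  funMap {n} (f : Skand.Func.{u} n) _ := match f with
    | .name ν => (E.ord ν).elems
  RelMap {n} (R : Skand.Pred n) := match n, R with
    | _, .ur => fun _ => False
    | _, .mem => fun v => Mem (v 0) (v 1)
    | _, .skand => fun v => IsSkandOf (v 0) (v 1)
    | _, .level => fun v => HasLevel (v 0) (v 1)

theorem mem_elems_right {e : E.{u}} {Y : Set E.{u}} : Mem e.elems Y ↔ e ∈ Y := by
  simp [Mem]

theorem forall_mem {Y : Set E.{u}} {P : Set E.{u} → Prop} :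
    (∀ X, Mem X Y → P X) ↔ ∀ e ∈ Y, P e.elems := by
  simp only [Mem]
  grind

/-! ### Truth in the model: notions of class theory -/

section Realize

variable {n : ℕ} {v : Empty → Set E.{u}} {xs : Fin n → Set E.{u}}

/-- The value of a term. -/
abbrev val (v : Empty → Set E.{u}) (xs : Fin n → Set E.{u}) (t : Skand.Tm.{u} n) : Set E.{u} :=
  Term.realize (Sum.elim v xs) t

@[simp]
theorem val_lift (t : Skand.Tm.{u} n) (X : Set E.{u}) :
    val v (Fin.snoc xs X) (Skand.lift t) = val v xs t := by
  rw [val, Skand.lift, Term.realize_relabel]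
  congr 1
  funext i
  rcases i with i | i <;> simp

@[simp]
theorem val_lastVar (X : Set E.{u}) : val v (Fin.snoc xs X) (Skand.lastVar n) = X := by
  simp [val, Skand.lastVar]

@[simp]
theorem val_name (ν : Ordinal.{u}) : val v xs (Skand.name ν) = (E.ord ν).elems := by
  simp only [val, Skand.name, Constants.term, Term.realize]
  rfl

@[simp]
theorem realize_all (φ : Skand.Tm.{u} (n + 1) → Skand.Fm.{u} (n + 1)) :
    (Skand.all φ).Realize v xs ↔
      ∀ X : Set E.{u}, (φ (Skand.lastVar n)).Realize v (Fin.snoc xs X) := Iff.rfl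

@[simp]
theorem realize_ex (φ : Skand.Tm.{u} (n + 1) → Skand.Fm.{u} (n + 1)) :
    (Skand.ex φ).Realize v xs ↔
      ∃ X : Set E.{u}, (φ (Skand.lastVar n)).Realize v (Fin.snoc xs X) :=
  BoundedFormula.realize_ex

@[simp]
theorem realize_conj (φ ψ : Skand.Fm.{u} n) :
    (Skand.conj φ ψ).Realize v xs ↔ φ.Realize v xs ∧ ψ.Realize v xs :=
  BoundedFormula.realize_inf

@[simp]
theorem realize_disj (φ ψ : Skand.Fm.{u} n) :
    (Skand.disj φ ψ).Realize v xs ↔ φ.Realize v xs ∨ ψ.Realize v xs :=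
  BoundedFormula.realize_sup

@[simp]
theorem realize_eq (x y : Skand.Tm.{u} n) :
    (Skand.eq x y).Realize v xs ↔ val v xs x = val v xs y := Iff.rfl

@[simp]
theorem realize_ur (x : Skand.Tm.{u} n) : (Skand.ur x).Realize v xs ↔ False :=
  BoundedFormula.realize_rel₁

@[simp]
theorem realize_mem (x y : Skand.Tm.{u} n) :
    (Skand.mem x y).Realize v xs ↔ Mem (val v xs x) (val v xs y) :=
  BoundedFormula.realize_rel₂

@[simp]
theorem realize_skand (x y : Skand.Tm.{u} n) :
    (Skand.skand x y).Realize v xs ↔ IsSkandOf (val v xs x) (val v xs y) :=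
  BoundedFormula.realize_rel₂

@[simp]
theorem realize_level (x y : Skand.Tm.{u} n) :
    (Skand.level x y).Realize v xs ↔ HasLevel (val v xs x) (val v xs y) :=
  BoundedFormula.realize_rel₂

@[simp]
theorem realize_isElem (x : Skand.Tm.{u} n) :
    (Skand.isElem x).Realize v xs ↔ ∃ e : E.{u}, e.elems = val v xs x := by
  simp only [Skand.isElem, realize_ex, realize_mem, val_lift, val_lastVar]
  exact ⟨fun ⟨_, e, h, _⟩ => ⟨e, h⟩, fun ⟨e, h⟩ => ⟨Set.univ, e, h, trivial⟩⟩

@[simp]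
theorem realize_isSet (x : Skand.Tm.{u} n) :
    (Skand.isSet x).Realize v xs ↔ ∃ e : E.{u}, e.elems = val v xs x := by
  simp [Skand.isSet]

@[simp]
theorem realize_sub (x y : Skand.Tm.{u} n) :
    (Skand.sub x y).Realize v xs ↔ val v xs x ⊆ val v xs y := by
  simp only [Skand.sub, realize_all, BoundedFormula.realize_imp, realize_mem, val_lift,
    val_lastVar, forall_mem, mem_elems_right]
  exact Iff.rfl

@[simp]
theorem realize_isUPair (s x y : Skand.Tm.{u} n) :
    (Skand.isUPair s x y).Realize v xs ↔ ∃ a b : E.{u},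
      a.elems = val v xs x ∧ b.elems = val v xs y ∧ (E.upair a b).elems = val v xs s := by
  simp only [Skand.isUPair, realize_conj, realize_isSet, realize_all, BoundedFormula.realize_iff,
    realize_mem, realize_disj, realize_eq, val_lift, val_lastVar]
  constructor
  · rintro ⟨-, h⟩
    -- Taking `z` to be `x` and then `y` in the defining equivalence forces both to be elements.
    obtain ⟨a, ha, ha'⟩ := (h _).2 (Or.inl rfl)
    obtain ⟨b, hb, hb'⟩ := (h _).2 (Or.inr rfl)
    refine ⟨a, b, ha, hb, ?_⟩
    ext c
    have := h c.elems
    rw [mem_elems_right, ← ha, ← hb, E.elems_inj, E.elems_inj] at this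
    rw [this, E.elems_upair]
    rfl
  · rintro ⟨a, b, ha, hb, hs⟩
    refine ⟨⟨_, hs⟩, fun X => ?_⟩
    rw [← ha, ← hb, ← hs, E.elems_upair, Mem]
    constructor
    · rintro ⟨e, rfl, rfl | rfl⟩
      exacts [Or.inl rfl, Or.inr rfl]
    · rintro (rfl | rfl)
      exacts [⟨a, rfl, Or.inl rfl⟩, ⟨b, rfl, Or.inr rfl⟩]

@[simp]
theorem realize_isPair (p x y : Skand.Tm.{u} n) :
    (Skand.isPair p x y).Realize v xs ↔ ∃ a b : E.{u},
      a.elems = val v xs x ∧ b.elems = val v xs y ∧ (E.pair a b).elems = val v xs p := by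
  simp only [Skand.isPair, realize_ex, realize_conj, realize_isUPair, val_lift, val_lastVar]
  constructor
  · rintro ⟨_, _, ⟨a, a', ha, ha', rfl⟩, ⟨a'', b, ha'', hb, rfl⟩, c, d, hc, hd, hp⟩
    rw [E.elems_inj] at hc hd
    obtain rfl := E.elems_injective (ha.trans ha'.symm)
    obtain rfl := E.elems_injective (ha.trans ha''.symm)
    subst hc hd
    exact ⟨a, b, ha, hb, hp⟩
  · rintro ⟨a, b, ha, hb, hp⟩
    exact ⟨_, _, ⟨a, a, ha, ha, rfl⟩, ⟨a, b, ha, hb, rfl⟩, _, _, rfl, rfl, hp⟩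

@[simp]
theorem realize_maps (f x y : Skand.Tm.{u} n) :
    (Skand.maps f x y).Realize v xs ↔ ∃ a b : E.{u},
      a.elems = val v xs x ∧ b.elems = val v xs y ∧ E.pair a b ∈ val v xs f := by
  simp only [Skand.maps, realize_ex, realize_conj, realize_isPair, realize_mem, val_lift,
    val_lastVar]
  constructor
  · rintro ⟨_, ⟨a, b, ha, hb, rfl⟩, h⟩
    exact ⟨a, b, ha, hb, mem_elems_right.1 h⟩
  · rintro ⟨a, b, ha, hb, h⟩
    exact ⟨_, ⟨a, b, ha, hb, rfl⟩, mem_elems_right.2 h⟩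

@[simp]
theorem realize_isOrd (a : Skand.Tm.{u} n) :
    (Skand.isOrd a).Realize v xs ↔ ∃ o, (E.ord o).elems = val v xs a := by
  simp only [Skand.isOrd, realize_conj, realize_isSet, realize_all, BoundedFormula.realize_imp,
    realize_mem, realize_sub, realize_disj, realize_eq, realize_ex, BoundedFormula.realize_not,
    val_lift, val_lastVar]
  constructor
  · rintro ⟨⟨a, ha⟩, h₁, h₂, h₃⟩
    rw [← ha] at h₁ h₂ h₃ ⊢
    obtain ⟨o, rfl⟩ := E.exists_ord_eq (a := a) (fun x hx => (h₁ _ (mem_elems_right.2 hx)).2)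
      (fun x hx y hy => by
        simpa only [mem_elems_right, E.elems_inj] using
          h₂ x.elems y.elems ⟨mem_elems_right.2 hx, mem_elems_right.2 hy⟩)
      (fun s hs ⟨x, hx⟩ => by
        obtain ⟨_, ⟨m, rfl, hm⟩, hmin⟩ :=
          h₃ s.elems ⟨⟨s, rfl⟩, hs, x.elems, mem_elems_right.2 hx⟩
        exact ⟨m, hm, fun y hy hym => hmin y.elems (mem_elems_right.2 hy)
          (mem_elems_right.2 hym)⟩)
    exact ⟨o, rfl⟩
  · rintro ⟨o, ho⟩
    rw [← ho]
    refine ⟨⟨_, rfl⟩, ?_, ?_, ?_⟩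
    · rintro _ ⟨e, rfl, he⟩
      refine ⟨⟨e, rfl⟩, fun z hz => ?_⟩
      obtain ⟨p, hp, rfl⟩ := E.mem_elems_ord.1 he
      obtain ⟨q, hq, rfl⟩ := E.mem_elems_ord.1 hz
      exact E.ord_mem_elems_ord.2 (hq.trans hp)
    · rintro _ _ ⟨⟨d, rfl, hd⟩, ⟨e, rfl, he⟩⟩
      obtain ⟨p, hp, rfl⟩ := E.mem_elems_ord.1 hd
      obtain ⟨q, hq, rfl⟩ := E.mem_elems_ord.1 he
      simpa only [mem_elems_right, E.ord_mem_elems_ord, E.elems_inj, E.ord_inj] using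
        lt_trichotomy p q
    · rintro S ⟨-, hS, _, ⟨e, rfl, he⟩⟩
      have hne : {p | E.ord p ∈ S}.Nonempty := by
        obtain ⟨p, -, rfl⟩ := E.mem_elems_ord.1 (hS he)
        exact ⟨p, he⟩
      -- The least index occurring in `S` gives a minimal element.
      refine ⟨_, ⟨E.ord (sInf {p | E.ord p ∈ S}), rfl, csInf_mem hne⟩, ?_⟩
      rintro _ ⟨d, rfl, hd⟩ hlt
      obtain ⟨p, -, rfl⟩ := E.mem_elems_ord.1 (hS hd)
      rw [mem_elems_right, E.ord_mem_elems_ord] at hlt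
      exact hlt.not_ge (csInf_le' hd)

end Realize

/-! ### The axioms of class theory -/

theorem realize_sentence (φ : Skand.Lang.{u}.Sentence) :
    Set E.{u} ⊨ φ ↔ BoundedFormula.Realize φ (Empty.elim : Empty → Set E.{u}) Fin.elim0 :=
  iff_of_eq (congrArg₂ (BoundedFormula.Realize φ) (Subsingleton.elim _ _) (Subsingleton.elim _ _))

/-- Whatever the relativized formula means, the set of all `e` satisfying it is an object of the
model. -/
theorem models_comprehension {n : ℕ} (φ : Skand.Fm.{u} (n + 1)) :
    Set E.{u} ⊨ Skand.comprehension φ := by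
  suffices h : ∀ v : Empty → Set E.{u}, Formula.Realize (Skand.comprehension φ) v from h _
  intro v
  refine BoundedFormula.realize_alls.2 fun xs => ?_
  simp only [realize_ex, realize_conj, BoundedFormula.realize_not, realize_ur, realize_all,
    BoundedFormula.realize_iff, realize_mem, realize_isElem, val_lift, val_lastVar]
  refine ⟨{e | (Skand.relativize φ).Realize v (Fin.snoc xs e.elems)}, not_false, fun X => ?_⟩
  rw [BoundedFormula.realize_liftAt_one (by omega)]
  -- The lifting moves the variable `n` past the position of `K`, so the formula sees the parameters
  -- followed by `X`.
  have key : ((Fin.snoc (Fin.snoc xs {e : E.{u} | (Skand.relativize φ).Realize v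
      (Fin.snoc xs e.elems)} : Fin (n + 1) → Set E.{u}) X : Fin (n + 1 + 1) → Set E.{u}) ∘
      fun i : Fin (n + 1) => if (i : ℕ) < n then i.castSucc else i.succ) = Fin.snoc xs X := by
    funext i
    refine Fin.lastCases ?_ (fun j => ?_) i
    · simp
    · simp
  rw [key]
  constructor
  · rintro ⟨e, rfl, he⟩
    exact ⟨⟨e, rfl⟩, he⟩
  · rintro ⟨⟨e, rfl⟩, he⟩
    exact ⟨e, rfl, he⟩

theorem models_individuals : Set E.{u} ⊨ Skand.individuals.{u} := by
  simp [realize_sentence, Skand.individuals]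

theorem models_extensionality : Set E.{u} ⊨ Skand.extensionality.{u} := by
  simp only [realize_sentence, Skand.extensionality, realize_all, BoundedFormula.realize_imp,
    realize_conj, BoundedFormula.realize_not, realize_ur, BoundedFormula.realize_iff, realize_mem,
    realize_eq, val_lift, val_lastVar]
  rintro X Y ⟨-, -, h⟩
  ext e
  simpa only [mem_elems_right] using h e.elems

theorem models_pairing : Set E.{u} ⊨ Skand.pairing.{u} := by
  simp only [realize_sentence, Skand.pairing, realize_all, BoundedFormula.realize_imp,
    realize_conj, realize_isElem, realize_ex, realize_isUPair, val_lift, val_lastVar]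
  rintro _ _ ⟨⟨a, rfl⟩, b, rfl⟩
  exact ⟨_, a, b, rfl, rfl, rfl⟩

theorem models_union : Set E.{u} ⊨ Skand.union.{u} := by
  simp only [realize_sentence, Skand.union, realize_all, BoundedFormula.realize_imp,
    realize_conj, realize_isSet, realize_ex, BoundedFormula.realize_iff, realize_mem, val_lift,
    val_lastVar]
  rintro _ ⟨a, rfl⟩
  refine ⟨_, ⟨E.of (⋃ y ∈ a.elems, y.elems), rfl⟩, fun X => ?_⟩
  rw [E.elems_of]
  constructor
  · rintro ⟨e, rfl, he⟩
    obtain ⟨y, hy, he⟩ := Set.mem_iUnion₂.1 he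
    exact ⟨_, mem_elems_right.2 hy, mem_elems_right.2 he⟩
  · rintro ⟨_, ⟨y, rfl, hy⟩, ⟨e, rfl, he⟩⟩
    exact ⟨e, rfl, Set.mem_iUnion₂.2 ⟨y, hy, he⟩⟩

theorem models_powerSet : Set E.{u} ⊨ Skand.powerSet.{u} := by
  simp only [realize_sentence, Skand.powerSet, realize_all, BoundedFormula.realize_imp,
    realize_conj, realize_isSet, realize_ex, BoundedFormula.realize_iff, realize_mem, realize_sub,
    val_lift, val_lastVar]
  rintro _ ⟨a, rfl⟩
  have : Small.{u} {e : E.{u} | e.elems ⊆ a.elems} :=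
    small_of_injective (f := fun e : {e : E.{u} | e.elems ⊆ a.elems} =>
      (⟨e.1.elems, e.2⟩ : 𝒫 a.elems))
      fun d e h => Subtype.ext (E.elems_injective (Subtype.mk.inj h))
  refine ⟨_, ⟨E.of {e | e.elems ⊆ a.elems}, rfl⟩, fun X => ?_⟩
  rw [E.elems_of]
  constructor
  · rintro ⟨e, rfl, he⟩
    exact ⟨⟨e, rfl⟩, he⟩
  · rintro ⟨⟨e, rfl⟩, he⟩
    exact ⟨e, rfl, he⟩

theorem mem_ord_succ {o : Ordinal.{u}} {X : Set E.{u}} : Mem X (E.ord (succ o)).elems ↔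
    Mem X (E.ord o).elems ∨ X = (E.ord o).elems := by
  constructor
  · rintro ⟨e, rfl, he⟩
    obtain ⟨p, hp, rfl⟩ := E.mem_elems_ord.1 he
    rcases (lt_succ_iff.1 hp).lt_or_eq with hp | rfl
    · exact Or.inl (mem_elems_right.2 (E.ord_mem_elems_ord.2 hp))
    · exact Or.inr rfl
  · rintro (⟨e, rfl, he⟩ | rfl)
    · obtain ⟨p, hp, rfl⟩ := E.mem_elems_ord.1 he
      exact mem_elems_right.2 (E.ord_mem_elems_ord.2 (hp.trans (lt_succ o)))
    · exact mem_elems_right.2 (E.ord_mem_elems_ord.2 (lt_succ o))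

theorem elems_ord_zero : (E.ord.{u} 0).elems = ∅ := by
  ext x
  simp [E.mem_elems_ord]

theorem models_infinity : Set E.{u} ⊨ Skand.infinity.{u} := by
  simp only [realize_sentence, Skand.infinity, realize_all, BoundedFormula.realize_imp,
    realize_conj, realize_isSet, realize_ex, BoundedFormula.realize_iff, realize_mem, realize_eq,
    BoundedFormula.realize_not, realize_disj, val_lift, val_lastVar]
  refine ⟨_, ⟨E.ord ω, rfl⟩, ⟨_, ⟨E.ord 0, rfl, ?_⟩, ⟨_, rfl⟩, ?_⟩, ?_⟩
  · exact E.ord_mem_elems_ord.2 omega0_pos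
  · rintro X ⟨e, -, he⟩
    rwa [elems_ord_zero] at he
  · rintro _ ⟨e, rfl, he⟩
    obtain ⟨p, hp, rfl⟩ := E.mem_elems_ord.1 he
    exact ⟨_, mem_elems_right.2 (E.ord_mem_elems_ord.2 (isSuccLimit_omega0.succ_lt hp)),
      fun X => mem_ord_succ⟩

theorem models_replacement : Set E.{u} ⊨ Skand.replacement.{u} := by
  simp only [realize_sentence, Skand.replacement, realize_all, BoundedFormula.realize_imp,
    realize_conj, realize_isSet, realize_ex, BoundedFormula.realize_iff, realize_mem, realize_eq,
    realize_maps, val_lift, val_lastVar]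
  rintro F hF _ ⟨a, rfl⟩
  have hF' : ∀ x y z : E.{u}, E.pair x y ∈ F → E.pair x z ∈ F → y = z := fun x y z hy hz =>
    E.elems_injective (hF x.elems y.elems z.elems ⟨⟨x, y, rfl, rfl, hy⟩, ⟨x, z, rfl, rfl, hz⟩⟩)
  have : Small.{u} {y : E.{u} | ∃ x ∈ a.elems, E.pair x y ∈ F} := by
    -- Each value is sent to a chosen argument in `a`; since `F` is functional, the argument
    -- determines the value.
    refine small_of_injective (f := fun y : {y : E.{u} | ∃ x ∈ a.elems, E.pair x y ∈ F} =>
      (⟨y.2.choose, y.2.choose_spec.1⟩ : a.elems)) fun y z h => Subtype.ext ?_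
    refine hF' _ _ _ y.2.choose_spec.2 ?_
    rw [Subtype.mk.inj h]
    exact z.2.choose_spec.2
  refine ⟨_, ⟨E.of {y | ∃ x ∈ a.elems, E.pair x y ∈ F}, rfl⟩, fun X => ?_⟩
  rw [E.elems_of]
  constructor
  · rintro ⟨y, rfl, x, hx, h⟩
    exact ⟨_, mem_elems_right.2 hx, x, y, rfl, rfl, h⟩
  · rintro ⟨_, hx, x, y, rfl, rfl, h⟩
    exact ⟨y, rfl, x, mem_elems_right.1 hx, h⟩

theorem models_axiomN : Set E.{u} ⊨ Skand.axiomN.{u} := by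
  simp only [realize_sentence, Skand.axiomN, realize_all, BoundedFormula.realize_imp,
    realize_conj, realize_isSet, realize_ex, BoundedFormula.realize_iff, realize_eq,
    realize_maps, realize_isOrd, val_lift, val_lastVar]
  obtain ⟨F⟩ := E.nonempty_equiv_ordinal.{u}
  have hF : ∀ x y : E.{u}, E.pair x y ∈ {p | ∃ e, E.pair e (E.ord (F e)) = p} ↔
      y = E.ord (F x) := by
    refine fun x y => ⟨?_, fun h => ⟨x, by rw [h]⟩⟩
    rintro ⟨e, h⟩
    obtain ⟨rfl, rfl⟩ := E.pair_inj.1 h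
    rfl
  refine ⟨{p | ∃ e, E.pair e (E.ord (F e)) = p}, ?_, ?_, ?_, ?_⟩
  · rintro _ ⟨x, rfl⟩
    exact ⟨_, x, _, rfl, rfl, (hF _ _).2 rfl⟩
  · rintro _ ⟨o, rfl⟩
    exact ⟨_, F.symm o, _, rfl, rfl, (hF _ _).2 (by rw [F.apply_symm_apply])⟩
  · rintro _ _ ⟨x, y, rfl, rfl, h⟩
    rw [hF] at h
    exact ⟨⟨x, rfl⟩, F x, by rw [h]⟩
  · rintro _ _ _ _ ⟨⟨x, a, rfl, rfl, hx⟩, ⟨y, b, rfl, rfl, hy⟩⟩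
    rw [hF] at hx hy
    rw [hx, hy, E.elems_inj, E.elems_inj, E.ord_inj, F.apply_eq_iff_eq]

theorem models_nbgMinus : Set E.{u} ⊨ Skand.nbgMinus.{u} := by
  rw [Theory.model_iff]
  rintro φ (h | h)
  · simp only [Set.mem_insert_iff, Set.mem_singleton_iff] at h
    rcases h with rfl | rfl | rfl | rfl | rfl | rfl | rfl | rfl
    exacts [models_individuals, models_extensionality, models_pairing, models_union,
      models_powerSet, models_infinity, models_replacement, models_axiomN]
  · obtain ⟨n, ψ, rfl⟩ := Set.mem_iUnion.1 h
    exact models_comprehension ψ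

/-! ### The names of the ordinals -/

theorem models_naming (l : Ordinal.{u}) : Set E.{u} ⊨ Skand.naming.{u} l := by
  rw [Theory.model_iff]
  rintro φ ((((⟨ν, -, rfl⟩ | ⟨μ, ν, h, -, rfl⟩) | rfl) | ⟨ν, -, rfl⟩) | ⟨ν, -, hν, rfl⟩)
  · rw [realize_sentence, realize_isOrd, val_name]
    exact ⟨ν, rfl⟩
  · rw [realize_sentence, realize_mem, val_name, val_name, mem_elems_right, E.ord_mem_elems_ord]
    exact h
  · simp only [realize_sentence, realize_all, BoundedFormula.realize_not, realize_mem, val_name]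
    rintro X ⟨e, -, he⟩
    rwa [elems_ord_zero] at he
  · simp only [realize_sentence, realize_all, BoundedFormula.realize_iff, realize_mem, val_name,
      realize_disj, realize_eq, val_lastVar]
    exact fun X => mem_ord_succ
  · simp only [realize_sentence, realize_all, BoundedFormula.realize_imp, realize_mem, val_name,
      realize_ex, realize_conj, val_lift, val_lastVar]
    rintro _ ⟨e, rfl, he⟩
    obtain ⟨p, hp, rfl⟩ := E.mem_elems_ord.1 he
    exact ⟨_, mem_elems_right.2 (E.ord_mem_elems_ord.2 (hν.succ_lt hp)),
      mem_elems_right.2 (E.ord_mem_elems_ord.2 (lt_succ p))⟩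

/-! ### Coded sequences -/

/-- Sequences with an order isomorphism of the index sets under which corresponding components are
equal are equal. -/
theorem Sq.eq_of_similar {X : Type (u + 1)} {s t : Sq X} (R : Ordinal.{u} → Ordinal.{u} → Prop)
    (hs : ∀ β < s.len, ∃ γ < t.len, R β γ ∧ s.comp β = t.comp γ)
    (ht : ∀ γ < t.len, ∃ β < s.len, R β γ ∧ s.comp β = t.comp γ)
    (hR : ∀ β γ β' γ', R β γ → R β' γ' → (β < β' ↔ γ < γ')) : s = t := by
  -- An order isomorphism between ordinals is the identity: at the first discrepancy, the partner of
  -- the smaller of `β` and `γ` contradicts the induction hypothesis.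
  have key : ∀ β < s.len, ∀ γ < t.len, R β γ → β = γ := by
    intro β
    induction β using WellFoundedLT.induction with
    | ind β ih =>
      intro hβ γ hγ hr
      rcases lt_trichotomy β γ with h | h | h
      · obtain ⟨β', hβ', hr', -⟩ := ht β (h.trans hγ)
        have hlt := (hR _ _ _ _ hr' hr).2 h
        exact (hlt.ne (ih β' hlt hβ' β (h.trans hγ) hr')).elim
      · exact h
      · obtain ⟨γ', hγ', hr', -⟩ := hs γ (h.trans hβ)
        have heq := ih γ h (h.trans hβ) γ' hγ' hr'
        exact (((hR _ _ _ _ hr' hr).1 h).ne heq.symm).elim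
  have hlen : s.len = t.len := le_antisymm
    (le_of_forall_lt fun β hβ => by
      obtain ⟨γ, hγ, hr, -⟩ := hs β hβ
      rwa [key β hβ γ hγ hr])
    (le_of_forall_lt fun γ hγ => by
      obtain ⟨β, hβ, hr, -⟩ := ht γ hγ
      rwa [← key β hβ γ hγ hr])
  ext1
  · exact hlen
  · funext β
    rcases lt_or_ge β s.len with hβ | hβ
    · obtain ⟨γ, hγ, hr, h⟩ := hs β hβ
      rw [h, key β hβ γ hγ hr]
    · rw [s.comp_eq_empty β hβ, t.comp_eq_empty β (hlen ▸ hβ)]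

theorem Sq.exists_elems_eq_comp (s : Sq E.{u}) (β : Ordinal.{u}) :
    ∃ y : E.{u}, y.elems = s.comp β :=
  have := s.small_comp β
  E.exists_elems_eq _

namespace Codes

theorem pair_mem_iff {f : E.{u}} {a : Ordinal.{u}} {s : Sq E.{u}} (h : Codes f a s) {x y : E.{u}} :
    E.pair x y ∈ f.elems ↔ ∃ β < s.len, E.ord (a + β) = x ∧ y.elems = s.comp β := by
  rw [h.2]
  constructor
  · rintro ⟨β, hβ, z, hz, e⟩
    obtain ⟨rfl, rfl⟩ := E.pair_inj.1 e
    exact ⟨β, hβ, rfl, hz⟩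
  · rintro ⟨β, hβ, rfl, hy⟩
    exact ⟨β, hβ, y, hy, rfl⟩

/-- Positions that carry the same index in `f` form a similarity, so `a = b` need not be shown
first. -/
theorem unique {f : E.{u}} {a b : Ordinal.{u}} {s t : Sq E.{u}} (hs : Codes f a s)
    (ht : Codes f b t) : s = t := by
  refine Sq.eq_of_similar (fun β γ => a + β = b + γ) (fun β hβ => ?_) (fun γ hγ => ?_) ?_
  · obtain ⟨y, hy⟩ := s.exists_elems_eq_comp β
    obtain ⟨γ, hγ, h, hy'⟩ := ht.pair_mem_iff.1 (hs.pair_mem_iff.2 ⟨β, hβ, rfl, hy⟩)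
    exact ⟨γ, hγ, (E.ord_inj.1 h).symm, hy.symm.trans hy'⟩
  · obtain ⟨y, hy⟩ := t.exists_elems_eq_comp γ
    obtain ⟨β, hβ, h, hy'⟩ := hs.pair_mem_iff.1 (ht.pair_mem_iff.2 ⟨γ, hγ, rfl, hy⟩)
    exact ⟨β, hβ, E.ord_inj.1 h, hy'.symm.trans hy⟩
  · intro β γ β' γ' h h'
    rw [← add_lt_add_iff_left a, h, h', add_lt_add_iff_left]

theorem exists_code (s : Sq E.{u}) (h : 0 < s.len) : ∃ f, Codes f 0 s := by
  have hs := s.small_comp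
  obtain ⟨f, hf⟩ := E.exists_elems_eq
    (Set.range fun β : Set.Iio s.len => E.pair (E.ord (0 + β.1)) (E.of (s.comp β.1)))
  refine ⟨f, h, ?_⟩
  rw [hf]
  ext p
  constructor
  · rintro ⟨⟨β, hβ⟩, rfl⟩
    exact ⟨β, hβ, _, E.elems_of _, rfl⟩
  · rintro ⟨β, hβ, y, hy, rfl⟩
    refine ⟨⟨β, hβ⟩, ?_⟩
    exact E.pair_inj.2 ⟨rfl, E.elems_injective ((E.elems_of _).trans hy.symm)⟩

theorem exists_tail {f : E.{u}} {a : Ordinal.{u}} {s : Sq E.{u}} (h : Codes f a s) :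
    ∃ g : E.{u}, g.elems = {p | ∃ β < s.len, 0 < β ∧
      ∃ y : E.{u}, y.elems = s.comp β ∧ E.pair (E.ord (a + β)) y = p} := by
  have : Small.{u} {p | ∃ β < s.len, 0 < β ∧
      ∃ y : E.{u}, y.elems = s.comp β ∧ E.pair (E.ord (a + β)) y = p} := by
    refine small_subset (s := f.elems) ?_
    rw [h.2]
    rintro p ⟨β, hβ, -, hp⟩
    exact ⟨β, hβ, hp⟩
  exact E.exists_elems_eq _

/-- The new starting index is `a + 1` because a + (1 + β) = (a + 1) + β. -/
theorem tail {g : E.{u}} {a : Ordinal.{u}} {s : Sq E.{u}} (h : 1 < s.len)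
    (hg : g.elems = {p | ∃ β < s.len, 0 < β ∧
      ∃ y : E.{u}, y.elems = s.comp β ∧ E.pair (E.ord (a + β)) y = p}) :
    Codes g (a + 1) s.tail := by
  refine ⟨Sq.len_tail_pos h, ?_⟩
  rw [hg]
  ext p
  constructor
  · rintro ⟨β, hβ, h₀, y, hy, rfl⟩
    have h₁ : 1 + (β - 1) = β := Ordinal.add_sub_cancel_of_le (Order.one_le_iff_pos.2 h₀)
    refine ⟨β - 1, ?_, y, ?_, ?_⟩
    · rwa [← add_lt_add_iff_left 1, h₁, Sq.one_add_len_tail (zero_lt_one.trans h)]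
    · rw [hy]
      exact congrArg s.comp h₁.symm
    · rw [add_assoc, h₁]
  · rintro ⟨β, hβ, y, hy, rfl⟩
    refine ⟨1 + β, ?_, ?_, y, hy, by rw [add_assoc]⟩
    · rwa [← Sq.one_add_len_tail (zero_lt_one.trans h), add_lt_add_iff_left]
    · exact zero_lt_one.trans_le (le_self_add)

end Codes

theorem isSkandOf_iff {f : E.{u}} {a : Ordinal.{u}} {s : Sq E.{u}} (h : Codes f a s)
    {X : Set E.{u}} : IsSkandOf f.elems X ↔ ∃ e : E.{u}, e.elems = X ∧ Gives s e := by
  constructor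
  · rintro ⟨g, b, t, e, hg, he, hc, ht⟩
    obtain rfl := E.elems_injective hg
    obtain rfl := hc.unique h
    exact ⟨e, he, ht⟩
  · rintro ⟨e, he, hs⟩
    exact ⟨f, a, s, e, rfl, he, h, hs⟩

theorem hasLevel_iff {o : Ordinal.{u}} {X : Set E.{u}} :
    HasLevel (E.ord o).elems X ↔ ∃ e : E.{u}, e.elems = X ∧ e.level ≤ o := by
  constructor
  · rintro ⟨p, e, hp, he, hl⟩
    obtain rfl := E.ord_injective (E.elems_injective hp)
    exact ⟨e, he, hl⟩
  · rintro ⟨e, he, hl⟩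
    exact ⟨o, e, rfl, he, hl⟩

theorem exists_hasLevel_iff {o : Ordinal.{u}} {X : Set E.{u}} :
    (∃ M, Mem M (E.ord o).elems ∧ HasLevel M X) ↔ ∃ e : E.{u}, e.elems = X ∧ e.level < o := by
  constructor
  · rintro ⟨_, ⟨m, rfl, hm⟩, h⟩
    obtain ⟨p, hp, rfl⟩ := E.mem_elems_ord.1 hm
    obtain ⟨e, he, hl⟩ := hasLevel_iff.1 h
    exact ⟨e, he, hl.trans_lt hp⟩
  · rintro ⟨e, he, hl⟩
    exact ⟨_, mem_elems_right.2 (E.ord_mem_elems_ord.2 hl), hasLevel_iff.2 ⟨e, he, le_rfl⟩⟩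

/-! ### Evaluation of the notions of the theory of skands -/

section Realize

variable {n : ℕ} {v : Empty → Set E.{u}} {xs : Fin n → Set E.{u}}

theorem realize_below {ν z : Skand.Tm.{u} n} {o : Ordinal.{u}}
    (hν : val v xs ν = (E.ord o).elems) :
    (Skand.below ν z).Realize v xs ↔ ∃ e : E.{u}, e.elems = val v xs z ∧ e.level < o := by
  simp only [Skand.below, realize_disj, realize_ur, false_or, realize_ex, realize_conj,
    realize_mem, realize_level, val_lift, val_lastVar, hν, exists_hasLevel_iff]

/-- The interval from `a` to `b` is renumbered as `a + β` with `β < b - a`, again by left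
subtraction; the bound on the level expresses both ν ≥ 1 and the condition on the components. -/
theorem realize_isSeq {ν f : Skand.Tm.{u} n} {o : Ordinal.{u}}
    (hν : val v xs ν = (E.ord o).elems) :
    (Skand.isSeq ν f).Realize v xs ↔
      ∃ g a s, E.elems g = val v xs f ∧ Codes g a s ∧ s.level E.level ≤ o := by
  have hb : ∀ A B C : Set E.{u}, (Skand.below (Skand.lift (Skand.lift (Skand.lift ν)))
      (Skand.lastVar (n + 2))).Realize v (Fin.snoc (Fin.snoc (Fin.snoc xs A) B) C) ↔
      ∃ e : E.{u}, e.elems = C ∧ e.level < o := fun A B C => by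
    rw [realize_below (o := o) (by simpa only [val_lift] using hν), val_lastVar]
  simp only [Skand.isSeq, realize_conj, realize_ex, realize_mem, realize_isSet, realize_isOrd,
    realize_all, BoundedFormula.realize_imp, realize_isPair, realize_disj, realize_eq,
    realize_maps, val_lift, val_lastVar, hν, hb]
  constructor
  · rintro ⟨⟨_, m, -, hm⟩, ⟨g, hg⟩, ⟨_, _, ⟨a, rfl⟩, ⟨b, rfl⟩, hab, h₁, h₂⟩, h₃, h₄⟩
    rw [mem_elems_right, E.ord_mem_elems_ord] at hab
    simp only [← hg] at *
    have hdom : ∀ x y, E.pair x y ∈ g.elems → ∃ β < b - a, E.ord (a + β) = x := by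
      intro x y hxy
      obtain ⟨_, _, ⟨x', y', rfl, rfl, hp⟩, hx, hxb⟩ := h₁ _ (mem_elems_right.2 hxy)
      obtain ⟨rfl, rfl⟩ := E.pair_inj.1 (E.elems_injective hp)
      obtain ⟨c, hc, rfl⟩ := E.mem_elems_ord.1 (mem_elems_right.1 hxb)
      rw [mem_elems_right, E.elems_inj, E.ord_inj, E.ord_mem_elems_ord] at hx
      have hac : a ≤ c := hx.elim (fun h => h.ge) le_of_lt
      refine ⟨c - a, ?_, by rw [Ordinal.add_sub_cancel_of_le hac]⟩
      rwa [Ordinal.lt_sub, Ordinal.add_sub_cancel_of_le hac]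
    have hex : ∀ β < b - a, ∃ y, E.pair (E.ord (a + β)) y ∈ g.elems := by
      intro β hβ
      rw [Ordinal.lt_sub] at hβ
      have hle : (E.ord (a + β)).elems = (E.ord a).elems ∨
          Mem (E.ord a).elems (E.ord (a + β)).elems := by
        rw [mem_elems_right, E.elems_inj, E.ord_inj, E.ord_mem_elems_ord]
        exact (le_self_add (a := a) (b := β)).eq_or_lt.imp_left Eq.symm
      obtain ⟨_, x, y, hx, rfl, hxy⟩ :=
        h₂ _ ⟨hle, mem_elems_right.2 (E.ord_mem_elems_ord.2 hβ)⟩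
      exact ⟨y, E.elems_injective hx ▸ hxy⟩
    have huniq : ∀ x y z, E.pair x y ∈ g.elems → E.pair x z ∈ g.elems → y = z :=
      fun x y z hy hz => E.elems_injective (h₃ x.elems y.elems z.elems
        ⟨⟨x, y, rfl, rfl, hy⟩, ⟨x, z, rfl, rfl, hz⟩⟩)
    have hcomp : ∀ β y, E.pair (E.ord (a + β)) y ∈ g.elems →
        {z | ∃ y, E.pair (E.ord (a + β)) y ∈ g.elems ∧ z ∈ y.elems} = y.elems := by
      intro β y hy
      ext z
      refine ⟨?_, fun hz => ⟨y, hy, hz⟩⟩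
      rintro ⟨y', hy', hz⟩
      rwa [huniq _ _ _ hy hy']
    have hemp : ∀ β, b - a ≤ β →
        {z | ∃ y, E.pair (E.ord (a + β)) y ∈ g.elems ∧ z ∈ y.elems} = ∅ := by
      intro β hβ
      refine Set.eq_empty_of_forall_notMem ?_
      rintro z ⟨y, hy, -⟩
      obtain ⟨γ, hγ, h⟩ := hdom _ _ hy
      rw [E.ord_inj, add_right_inj] at h
      exact (h ▸ hγ).not_ge hβ
    -- Writing a component as the union of all values at `a + β` makes it empty past the end, as
    -- `Sq` requires.
    refine ⟨g, a, ⟨b - a, fun β => {z | ∃ y, E.pair (E.ord (a + β)) y ∈ g.elems ∧ z ∈ y.elems},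
      fun β => ?_, hemp⟩, rfl, ⟨?_, ?_⟩, Sq.level_le_iff.2 ⟨?_, ?_⟩⟩
    · rcases lt_or_ge β (b - a) with hβ | hβ
      · obtain ⟨y, hy⟩ := hex β hβ
        rw [hcomp β y hy]
        infer_instance
      · rw [hemp β hβ]
        infer_instance
    · rw [Ordinal.lt_sub, add_zero]
      exact hab
    · ext p
      constructor
      · intro hp
        obtain ⟨_, _, ⟨x, y, rfl, rfl, hxy⟩, -⟩ := h₁ _ (mem_elems_right.2 hp)
        obtain rfl := E.elems_injective hxy
        obtain ⟨β, hβ, rfl⟩ := hdom _ _ hp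
        exact ⟨β, hβ, y, (hcomp β y hp).symm, rfl⟩
      · rintro ⟨β, hβ, y, hy, rfl⟩
        obtain ⟨y', hy'⟩ := hex β hβ
        rwa [E.elems_injective (hy.trans (hcomp β y' hy'))]
    · obtain ⟨p, hp, -⟩ := E.mem_elems_ord.1 hm
      exact Order.one_le_iff_pos.2 (bot_le.trans_lt hp)
    · rintro β z ⟨y, hy, hz⟩
      obtain ⟨e, he, hl⟩ := (h₄ _ _ ⟨_, y, rfl, rfl, hy⟩).2 z.elems (mem_elems_right.2 hz)
      rwa [← E.elems_injective he]
  · rintro ⟨g, a, s, hg, hc, hl⟩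
    obtain ⟨ho, hl⟩ := Sq.level_le_iff.1 hl
    rw [← hg]
    refine ⟨⟨_, mem_elems_right.2 (E.ord_mem_elems_ord.2 (Order.one_le_iff_pos.1 ho))⟩, ⟨g, rfl⟩,
      ⟨_, _, ⟨a, rfl⟩, ⟨a + s.len, rfl⟩, ?_, ?_, ?_⟩, ?_, ?_⟩
    · rw [mem_elems_right, E.ord_mem_elems_ord]
      simpa using hc.1
    · rintro _ ⟨p, rfl, hp⟩
      rw [hc.2] at hp
      obtain ⟨β, hβ, y, hy, rfl⟩ := hp
      refine ⟨_, _, ⟨_, y, rfl, rfl, rfl⟩, ?_, ?_⟩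
      · rw [mem_elems_right, E.elems_inj, E.ord_inj, E.ord_mem_elems_ord]
        exact (le_self_add (a := a) (b := β)).eq_or_lt.imp_left Eq.symm
      · rw [mem_elems_right, E.ord_mem_elems_ord]
        simpa using hβ
    · rintro _ ⟨hx, ⟨x, rfl, hxb⟩⟩
      obtain ⟨c, hcb, rfl⟩ := E.mem_elems_ord.1 hxb
      rw [mem_elems_right, E.elems_inj, E.ord_inj, E.ord_mem_elems_ord] at hx
      have hac : a ≤ c := hx.elim (fun h => h.ge) le_of_lt
      obtain ⟨y, hy⟩ := s.exists_elems_eq_comp (c - a)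
      refine ⟨_, _, y, rfl, rfl, hc.pair_mem_iff.2 ⟨c - a, ?_, ?_, hy⟩⟩
      · rwa [← add_lt_add_iff_left a, Ordinal.add_sub_cancel_of_le hac]
      · rw [Ordinal.add_sub_cancel_of_le hac]
    · rintro _ _ _ ⟨⟨x, y, rfl, rfl, hy⟩, ⟨x', z, hx, rfl, hz⟩⟩
      obtain rfl := E.elems_injective hx
      obtain ⟨β, -, rfl, hy'⟩ := hc.pair_mem_iff.1 hy
      obtain ⟨γ, -, h, hz'⟩ := hc.pair_mem_iff.1 hz
      rw [E.ord_inj, add_right_inj] at h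
      rw [hy', hz', h]
    · rintro _ _ ⟨x, y, rfl, rfl, hy⟩
      obtain ⟨β, -, rfl, hy'⟩ := hc.pair_mem_iff.1 hy
      refine ⟨⟨y, rfl⟩, ?_⟩
      rintro _ ⟨z, rfl, hz⟩
      exact ⟨z, rfl, hl β z (hy' ▸ hz)⟩

theorem realize_isSkand {ν y : Skand.Tm.{u} n} {o : Ordinal.{u}}
    (hν : val v xs ν = (E.ord o).elems) :
    (Skand.isSkand ν y).Realize v xs ↔
      ∃ s e, E.elems e = val v xs y ∧ Gives s e ∧ s.level E.level ≤ o := by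
  simp only [Skand.isSkand, realize_ex, realize_conj, realize_skand, val_lift, val_lastVar]
  constructor
  · rintro ⟨F, hF, hs⟩
    rw [realize_isSeq (o := o) (by simpa only [val_lift] using hν), val_lastVar] at hF
    obtain ⟨f, a, s, rfl, hc, hl⟩ := hF
    obtain ⟨e, he, hg⟩ := (isSkandOf_iff hc).1 hs
    exact ⟨s, e, he, hg, hl⟩
  · rintro ⟨s, e, he, hg, hl⟩
    obtain ⟨f, hf⟩ := Codes.exists_code s hg.pos
    refine ⟨f.elems, ?_, (isSkandOf_iff hf).2 ⟨e, he, hg⟩⟩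
    rw [realize_isSeq (o := o) (by simpa only [val_lift] using hν), val_lastVar]
    exact ⟨f, 0, s, rfl, hf, hl⟩

theorem realize_inFirst {f z : Skand.Tm.{u} n} {g : E.{u}} {a : Ordinal.{u}} {s : Sq E.{u}}
    (hf : val v xs f = g.elems) (hc : Codes g a s) :
    (Skand.inFirst f z).Realize v xs ↔ Mem (val v xs z) (s.comp 0) := by
  simp only [Skand.inFirst, realize_ex, realize_conj, realize_maps, realize_mem, realize_all,
    BoundedFormula.realize_imp, BoundedFormula.realize_not, val_lift, val_lastVar, hf]
  constructor
  · rintro ⟨_, _, ⟨x, y, rfl, rfl, hxy⟩, hz, hmin⟩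
    obtain ⟨β, hβ, rfl, hy⟩ := hc.pair_mem_iff.1 hxy
    obtain ⟨w, hw⟩ := s.exists_elems_eq_comp 0
    have := hmin _ _ ⟨_, w, rfl, rfl, hc.pair_mem_iff.2 ⟨0, hc.1, rfl, hw⟩⟩
    rw [mem_elems_right, E.ord_mem_elems_ord, add_lt_add_iff_left, not_lt, nonpos_iff_eq_zero]
      at this
    rwa [hy, this] at hz
  · intro hz
    obtain ⟨y, hy⟩ := s.exists_elems_eq_comp 0
    refine ⟨_, _, ⟨_, y, rfl, rfl, hc.pair_mem_iff.2 ⟨0, hc.1, rfl, hy⟩⟩, by rwa [hy], ?_⟩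
    rintro _ _ ⟨x, w, rfl, rfl, hw⟩
    obtain ⟨β, -, rfl, -⟩ := hc.pair_mem_iff.1 hw
    rw [mem_elems_right, E.ord_mem_elems_ord, add_lt_add_iff_left]
    exact not_lt_bot

theorem realize_isTail {f h : Skand.Tm.{u} n} {g : E.{u}} {a : Ordinal.{u}} {s : Sq E.{u}}
    (hf : val v xs f = g.elems) (hc : Codes g a s) :
    (Skand.isTail f h).Realize v xs ↔ val v xs h = {p | ∃ β < s.len, 0 < β ∧
      ∃ y : E.{u}, y.elems = s.comp β ∧ E.pair (E.ord (a + β)) y = p} := by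
  simp only [Skand.isTail, realize_ex, realize_conj, realize_maps, realize_mem, realize_all,
    BoundedFormula.realize_iff, realize_isSet, realize_isPair, val_lift, val_lastVar, hf]
  have key : ∀ p : E.{u}, (Mem p.elems g.elems ∧ ∃ A Y B W : Set E.{u},
      (∃ x y : E.{u}, x.elems = A ∧ y.elems = Y ∧ (E.pair x y).elems = p.elems) ∧
      (∃ x y : E.{u}, x.elems = B ∧ y.elems = W ∧ E.pair x y ∈ g.elems) ∧ Mem B A) ↔
      ∃ β < s.len, 0 < β ∧ ∃ y : E.{u}, y.elems = s.comp β ∧ E.pair (E.ord (a + β)) y = p := by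
    intro p
    constructor
    · rintro ⟨hp, _, _, _, _, ⟨x, y, rfl, rfl, hxy⟩, ⟨x', y', rfl, rfl, hxy'⟩, hlt⟩
      obtain rfl := E.elems_injective hxy
      obtain ⟨β, hβ, rfl, hy⟩ := hc.pair_mem_iff.1 (mem_elems_right.1 hp)
      obtain ⟨γ, -, rfl, -⟩ := hc.pair_mem_iff.1 hxy'
      rw [mem_elems_right, E.ord_mem_elems_ord, add_lt_add_iff_left] at hlt
      exact ⟨β, hβ, bot_le.trans_lt hlt, y, hy, rfl⟩
    · rintro ⟨β, hβ, h₀, y, hy, rfl⟩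
      obtain ⟨w, hw⟩ := s.exists_elems_eq_comp 0
      refine ⟨mem_elems_right.2 (hc.pair_mem_iff.2 ⟨β, hβ, rfl, hy⟩), _, _, _, _,
        ⟨_, y, rfl, rfl, rfl⟩, ⟨_, w, rfl, rfl, hc.pair_mem_iff.2 ⟨0, hc.1, rfl, hw⟩⟩, ?_⟩
      rw [mem_elems_right, E.ord_mem_elems_ord, add_lt_add_iff_left]
      exact h₀
  constructor
  · rintro ⟨-, h⟩
    ext p
    rw [← mem_elems_right, h, key]
    rfl
  · intro h
    rw [h]
    constructor
    · exact hc.exists_tail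
    · intro X
      constructor
      · rintro ⟨p, rfl, hp⟩
        exact (key p).2 hp
      · rintro ⟨⟨p, rfl, hp⟩, h'⟩
        exact ⟨p, rfl, (key p).1 ⟨mem_elems_right.2 hp, h'⟩⟩

/-- A `Sq` has forgotten the starting index, so similarity becomes equality; conversely the
isomorphism is the translation of `a + β` to `b + β`. -/
theorem realize_similar {f g : Skand.Tm.{u} n} {d e : E.{u}} {a b : Ordinal.{u}} {s t : Sq E.{u}}
    (hf : val v xs f = d.elems) (hg : val v xs g = e.elems) (hs : Codes d a s) (ht : Codes e b t) :
    (Skand.similar f g).Realize v xs ↔ s = t := by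
  simp only [Skand.similar, realize_ex, realize_conj, realize_maps, realize_mem, realize_all,
    BoundedFormula.realize_iff, BoundedFormula.realize_imp, realize_isSet, val_lift, val_lastVar,
    hf, hg]
  constructor
  · rintro ⟨H, -, h₁, h₂, h₃⟩
    refine Sq.eq_of_similar (fun β γ => E.pair (E.ord (a + β)) (E.ord (b + γ)) ∈ H)
      (fun β hβ => ?_) (fun γ hγ => ?_) fun β γ β' γ' h h' => ?_
    · obtain ⟨y, hy⟩ := s.exists_elems_eq_comp β
      obtain ⟨_, ⟨x₁, z₁, hx₁, rfl, hH⟩, ⟨x₂, z₂, hx₂, hz₂, he⟩⟩ :=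
        h₁ _ _ ⟨_, y, rfl, rfl, hs.pair_mem_iff.2 ⟨β, hβ, rfl, hy⟩⟩
      obtain rfl := E.elems_injective hx₁
      obtain rfl := E.elems_injective hx₂
      obtain rfl := E.elems_injective hz₂
      obtain ⟨γ, hγ, rfl, hy'⟩ := ht.pair_mem_iff.1 he
      exact ⟨γ, hγ, hH, hy.symm.trans hy'⟩
    · obtain ⟨y, hy⟩ := t.exists_elems_eq_comp γ
      obtain ⟨_, ⟨x₁, z₁, rfl, hz₁, hH⟩, ⟨x₂, z₂, hx₂, hz₂, he⟩⟩ :=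
        h₂ _ _ ⟨_, y, rfl, rfl, ht.pair_mem_iff.2 ⟨γ, hγ, rfl, hy⟩⟩
      obtain rfl := E.elems_injective hz₁
      obtain rfl := E.elems_injective hx₂
      obtain rfl := E.elems_injective hz₂
      obtain ⟨β, hβ, rfl, hy'⟩ := hs.pair_mem_iff.1 he
      exact ⟨β, hβ, hH, hy'.symm.trans hy⟩
    · have := h₃ _ _ _ _ ⟨⟨_, _, rfl, rfl, h⟩, ⟨_, _, rfl, rfl, h'⟩⟩
      simpa only [mem_elems_right, E.ord_mem_elems_ord, add_lt_add_iff_left] using this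
  · rintro rfl
    obtain ⟨h, hh⟩ := E.exists_elems_eq
      (Set.range fun β : Set.Iio s.len => E.pair (E.ord (a + β.1)) (E.ord (b + β.1)))
    refine ⟨h.elems, ⟨h, rfl⟩, ?_, ?_, ?_⟩
    · rintro _ _ ⟨x, y, rfl, rfl, hy⟩
      obtain ⟨β, hβ, rfl, hy'⟩ := hs.pair_mem_iff.1 hy
      exact ⟨_, ⟨_, _, rfl, rfl, hh ▸ ⟨⟨β, hβ⟩, rfl⟩⟩,
        ⟨_, y, rfl, rfl, ht.pair_mem_iff.2 ⟨β, hβ, rfl, hy'⟩⟩⟩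
    · rintro _ _ ⟨x, y, rfl, rfl, hy⟩
      obtain ⟨β, hβ, rfl, hy'⟩ := ht.pair_mem_iff.1 hy
      exact ⟨_, ⟨_, _, rfl, rfl, hh ▸ ⟨⟨β, hβ⟩, rfl⟩⟩,
        ⟨_, y, rfl, rfl, hs.pair_mem_iff.2 ⟨β, hβ, rfl, hy'⟩⟩⟩
    · rintro _ _ _ _ ⟨⟨x, y, rfl, rfl, hxy⟩, ⟨z, w, rfl, rfl, hzw⟩⟩
      rw [hh] at hxy hzw
      obtain ⟨⟨β, hβ⟩, h₁⟩ := hxy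
      obtain ⟨⟨γ, hγ⟩, h₂⟩ := hzw
      obtain ⟨rfl, rfl⟩ := E.pair_inj.1 h₁
      obtain ⟨rfl, rfl⟩ := E.pair_inj.1 h₂
      simp only [mem_elems_right, E.ord_mem_elems_ord, add_lt_add_iff_left]

theorem realize_closed {ν K : Skand.Tm.{u} n} {o : Ordinal.{u}}
    (hν : val v xs ν = (E.ord o).elems) :
    (Skand.closed ν K).Realize v xs ↔ (∀ e : E.{u}, e.level < o → e ∈ val v xs K) ∧
      ∀ e : E.{u}, e.elems ⊆ val v xs K → e ∈ val v xs K := by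
  simp only [Skand.closed, realize_ex, realize_conj, realize_mem, realize_all, realize_level,
    BoundedFormula.realize_imp, realize_isSet, realize_disj, realize_ur, false_or, val_lift,
    val_lastVar, hν, exists_hasLevel_iff, forall_mem, mem_elems_right]
  refine and_congr ⟨fun h e he => ?_, ?_⟩ ⟨fun h e he => ?_, ?_⟩
  · exact mem_elems_right.1 (h _ ⟨e, rfl, he⟩)
  · rintro h _ ⟨e, rfl, he⟩
    exact mem_elems_right.2 (h e he)
  · exact mem_elems_right.1 (h _ ⟨⟨e, rfl⟩, he⟩)
  · rintro h _ ⟨⟨e, rfl⟩, he⟩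
    exact mem_elems_right.2 (h e he)

theorem realize_isOld {ν x : Skand.Tm.{u} n} {o : Ordinal.{u}} {e : E.{u}}
    (hν : val v xs ν = (E.ord o).elems) (hx : val v xs x = e.elems) :
    (Skand.isOld ν x).Realize v xs ↔ ∀ K : Set E.{u}, (∀ y : E.{u}, y.level < o → y ∈ K) →
      (∀ y : E.{u}, y.elems ⊆ K → y ∈ K) → e ∈ K := by
  simp only [Skand.isOld, realize_conj, realize_isSet, realize_all, BoundedFormula.realize_imp,
    realize_mem, val_lift, val_lastVar, hx, mem_elems_right, E.elems_inj, exists_eq, true_and]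
  refine forall_congr' fun K => ?_
  rw [realize_closed (o := o) (by simpa only [val_lift] using hν), val_lastVar, and_imp]

theorem realize_isGenerated {ν x : Skand.Tm.{u} n} {o : Ordinal.{u}}
    (hν : val v xs ν = (E.ord o).elems) :
    (Skand.isGenerated ν x).Realize v xs ↔ ∃ e : E.{u}, e.elems = val v xs x ∧ e.level ≤ o := by
  have hb : ∀ K Y : Set E.{u}, (Skand.isSkand (Skand.lift (Skand.lift ν))
      (Skand.lastVar (n + 1))).Realize v (Fin.snoc (Fin.snoc xs K) Y) ↔
      ∃ s e, E.elems e = Y ∧ Gives s e ∧ s.level E.level ≤ o := fun K Y => by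
    rw [realize_isSkand (o := o) (by simpa only [val_lift] using hν), val_lastVar]
  have hc : ∀ K : Set E.{u}, (Skand.closed (Skand.lift ν) (Skand.lastVar n)).Realize v
      (Fin.snoc xs K) ↔ (∀ e : E.{u}, e.level < o → e ∈ K) ∧
      ∀ e : E.{u}, e.elems ⊆ K → e ∈ K := fun K => by
    rw [realize_closed (o := o) (by simpa only [val_lift] using hν), val_lastVar]
  simp only [Skand.isGenerated, realize_conj, realize_isSet, realize_all,
    BoundedFormula.realize_imp, realize_mem, val_lift, val_lastVar, hb, hc]
  constructor
  · rintro ⟨⟨e, he⟩, h⟩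
    refine ⟨e, he, ?_⟩
    rw [← he] at h
    -- The class of sets of level at most `o` is itself one of the closed classes containing the
    -- skands, so membership in it bounds the level.
    refine mem_elems_right.1 (h {e | e.level ≤ o} ⟨⟨fun e he => he.le, fun e he =>
      E.level_le_of_forall he⟩, ?_⟩)
    rintro _ ⟨s, e, rfl, hg, hl⟩
    exact mem_elems_right.2 (hg.level_le.trans hl)
  · rintro ⟨e, he, hl⟩
    refine ⟨⟨e, he⟩, ?_⟩
    rw [← he]
    rintro K ⟨⟨-, h₂⟩, h₃⟩
    exact mem_elems_right.2 (E.mem_of_level_le hl h₂ fun s y hg hs =>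
      mem_elems_right.1 (h₃ _ ⟨s, y, rfl, hg, hs⟩))

end Realize

/-! ### The skand axioms -/

theorem models_hierarchy : Set E.{u} ⊨ Skand.hierarchy.{u} fun ν => Skand.isOrd ν := by
  simp only [realize_sentence, Skand.hierarchy, realize_all, BoundedFormula.realize_iff,
    realize_level, realize_conj, realize_isOrd, val_lift, val_lastVar]
  intro N X
  constructor
  · rintro ⟨o, e, rfl, rfl, hl⟩
    refine ⟨⟨o, rfl⟩, (realize_isGenerated (o := o) (by simp only [val_lift, val_lastVar])).2 ?_⟩
    exact ⟨e, by rw [val_lastVar], hl⟩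
  · rintro ⟨⟨o, rfl⟩, h⟩
    rw [realize_isGenerated (o := o) (by simp only [val_lift, val_lastVar]), val_lastVar] at h
    exact hasLevel_iff.2 h

theorem models_skandExistence :
    Set E.{u} ⊨ Skand.skandExistence.{u} fun ν => Skand.isOrd ν := by
  simp only [realize_sentence, Skand.skandExistence, realize_all, BoundedFormula.realize_imp,
    realize_conj, realize_isOrd, realize_ex, realize_skand, val_lift, val_lastVar]
  rintro _ F ⟨⟨o, rfl⟩, h⟩
  rw [realize_isSeq (o := o) (by simp only [val_lift, val_lastVar]), val_lastVar] at h
  obtain ⟨f, a, s, rfl, hc, -⟩ := h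
  obtain ⟨e, he⟩ := Gives.exists_of_pos hc.1
  exact ⟨e.elems, (isSkandOf_iff hc).2 ⟨e, rfl, he⟩⟩

theorem models_skandSort : Set E.{u} ⊨ Skand.skandSort.{u} fun ν => Skand.isOrd ν := by
  simp only [realize_sentence, Skand.skandSort, realize_all, BoundedFormula.realize_imp,
    realize_conj, realize_isOrd, realize_ex, realize_skand, realize_isSet, val_lift, val_lastVar]
  rintro _ _ ⟨f, a, s, e, rfl, rfl, hc, -⟩
  -- The level of a sequence is the least ν for which it is a ν-sequence.
  refine ⟨⟨e, rfl⟩, _, ⟨s.level E.level, rfl⟩, ?_⟩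
  rw [realize_isSeq (o := s.level E.level) (by simp only [val_lastVar])]
  exact ⟨f, a, s, by simp only [val_lift, val_lastVar], hc, le_rfl⟩

theorem models_skandElements : Set E.{u} ⊨ Skand.skandElements.{u} := by
  simp only [realize_sentence, Skand.skandElements, realize_all, BoundedFormula.realize_imp,
    BoundedFormula.realize_iff, realize_disj, realize_conj, realize_ex, realize_mem, realize_skand,
    val_lift, val_lastVar]
  rintro _ _ ⟨f, a, s, e, rfl, rfl, hc, hg⟩ Z
  rw [realize_inFirst (by simp only [val_lift, val_lastVar]) hc, val_lastVar]
  have htail : ∀ G : Set E.{u}, _ ↔ _ := fun G => realize_isTail (v := Empty.elim)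
    (xs := Fin.snoc (Fin.snoc (Fin.snoc (Fin.snoc Fin.elim0 f.elems) e.elems) Z) G)
    (f := Skand.lift (Skand.lift (Skand.lift (Skand.lastVar 0)))) (h := Skand.lastVar 3)
    (by simp only [val_lift, val_lastVar]) hc
  constructor
  · rintro ⟨z, rfl, hz⟩
    rcases (hg.mem_elems_iff z).1 hz with hz | ⟨h₁, hz⟩
    · exact Or.inl (mem_elems_right.2 hz)
    · right
      obtain ⟨g, hg⟩ := hc.exists_tail
      refine ⟨g.elems, (htail _).2 (by rw [val_lastVar, hg]), ?_⟩
      exact (isSkandOf_iff (Codes.tail h₁ hg)).2 ⟨z, rfl, hz⟩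
  · rintro (⟨z, rfl, hz⟩ | ⟨G, hG, ⟨g, b, t, z, rfl, rfl, hcg, hz⟩⟩)
    · exact mem_elems_right.2 ((hg.mem_elems_iff z).2 (Or.inl hz))
    · have hG' := (htail _).1 hG
      rw [val_lastVar] at hG'
      -- Only nonempty sequences yield skands, so a tail that yields one leaves a component at a
      -- positive position.
      have h₁ : 1 < s.len := by
        obtain ⟨y, hy⟩ := t.exists_elems_eq_comp 0
        have hm := hcg.pair_mem_iff.2 ⟨0, hcg.1, rfl, hy⟩
        rw [hG'] at hm
        obtain ⟨β, hβ, h₀, -⟩ := hm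
        exact (Order.one_le_iff_pos.2 h₀).trans_lt hβ
      obtain rfl := hcg.unique (Codes.tail h₁ hG')
      exact mem_elems_right.2 ((hg.mem_elems_iff z).2 (Or.inr ⟨h₁, hz⟩))

theorem models_skandEquality : Set E.{u} ⊨ Skand.skandEquality.{u} := by
  simp only [realize_sentence, Skand.skandEquality, realize_all, BoundedFormula.realize_imp,
    realize_conj, realize_skand, realize_eq, val_lift, val_lastVar]
  rintro _ _ _ _ ⟨⟨f, a, s, d, rfl, rfl, hf, hs⟩, ⟨g, b, t, e, rfl, rfl, hg, ht⟩, h⟩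
  rw [realize_similar (by simp only [val_lift, val_lastVar])
    (by simp only [val_lift, val_lastVar]) hf hg] at h
  subst h
  rw [hs.unique ht]

/-- A skand not generated by lower levels can only arise from pure sequences, by `mem_or_pure`
applied to both, and a pure skand determines its sequence. -/
theorem models_skandInequality :
    Set E.{u} ⊨ Skand.skandInequality.{u} fun ν => Skand.isOrd ν := by
  simp only [realize_sentence, Skand.skandInequality, realize_all, BoundedFormula.realize_imp,
    realize_conj, realize_skand, realize_isOrd, BoundedFormula.realize_not, val_lift, val_lastVar]
  rintro _ _ _ _ ⟨⟨o, rfl⟩, hsf, hsg, ⟨f, a, s, e, rfl, rfl, hf, hs⟩,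
    ⟨g, b, t, d, rfl, hd, hg, ht⟩, hold⟩
  obtain rfl := E.elems_injective hd
  rw [realize_isSeq (o := o) (by simp only [val_lift, val_lastVar])] at hsf hsg
  simp only [val_lift, val_lastVar, E.elems_inj] at hsf hsg
  obtain ⟨_, a', s', rfl, hf', hsl⟩ := hsf
  obtain ⟨_, b', t', rfl, hg', htl⟩ := hsg
  obtain rfl := hf.unique hf'
  obtain rfl := hg.unique hg'
  rw [realize_similar (by simp only [val_lift, val_lastVar])
    (by simp only [val_lift, val_lastVar]) hf hg]
  by_contra hne
  refine hold ((realize_isOld (o := o) (by simp only [val_lift, val_lastVar])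
    (by simp only [val_lastVar]; rfl)).2 fun K h₁ h₂ => ?_)
  rcases hs.mem_or_pure hsl h₁ h₂ with h | ⟨hps, -⟩
  · exact h
  · rcases ht.mem_or_pure htl h₁ h₂ with h | ⟨hpt, -⟩
    · exact h
    · exact (hne (hs.eq_of_pure ht hps hpt)).elim

theorem models_exhaustion : Set E.{u} ⊨ Skand.exhaustion.{u} fun ν => Skand.isOrd ν := by
  simp only [realize_sentence, Skand.exhaustion, realize_all, BoundedFormula.realize_imp,
    realize_conj, realize_isSet, realize_ex, realize_isOrd, realize_level, val_lift, val_lastVar]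
  rintro _ ⟨e, rfl⟩
  exact ⟨_, ⟨e.level, rfl⟩, hasLevel_iff.2 ⟨e, rfl, le_rfl⟩⟩

theorem models_NBGOmega : Set E.{u} ⊨ Skand.NBGOmega.{u} := by
  rw [Theory.model_iff]
  rintro φ ((h | h) | h)
  · exact models_nbgMinus.realize_of_mem φ h
  · obtain ⟨l, h⟩ := Set.mem_iUnion.1 h
    exact (models_naming l).realize_of_mem φ h
  · simp only [Skand.skandAxioms, Set.mem_insert_iff, Set.mem_singleton_iff] at h
    rcases h with rfl | rfl | rfl | rfl | rfl | rfl | rfl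
    exacts [models_hierarchy, models_skandExistence, models_skandSort, models_skandElements,
      models_skandEquality, models_skandInequality, models_exhaustion]

end SkandModel

/-- The theory `NBG^(Ω)` holds in the structure `Set E` of all classes over the universe `E` of sets
generated by the skands, so that it is consistent; the assumption on the theories `NBG^(l)` is not
used. -/
theorem theorem3 (h : ∀ l : Ordinal.{u}, Skand.Consistent (Skand.NBG l)) :
    Skand.Consistent Skand.NBGOmega.{u} := by
  exact Skand.consistent_of_model (Set SkandModel.E.{u}) SkandModel.models_NBGOmega
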